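/- Let $\mathcal E$ be a finite-dimensional Euclidean space, let $p\ge 2$ be an integer, and let $\mathcal M_1,\mathcal M_2\subset\mathcal E$ be (non-empty) $C^{p,1}$ embedded submanifolds, i.e. given locally as zero sets of $C^{p,1}$ maps ($p$ times continuously differentiable with locally Lipschitz $p$-th derivative) whose differential is surjective at the point considered (open subsets of $\mathcal E$ being the case of codimension $0$). Put $\mathcal M=\mathcal M_1\cap\mathcal M_2$. For $D\subset\mathcal E$ write $d_D$ for the distance to $D$, $\mathcal P_D(y)=\operatorname{argmin}_{z\in D}\|z-y\|$ for the orthogonal projection onto $D$, and $\mathcal N_\delta(D)=\{y: d_D(y)<\delta\}$. Fix $\bar x\in\mathcal M$, a neighbourhood $\Omega$ of $\bar x$ that is open in $\mathcal M$, and let $K$ be the closure of $\Omega$ in $\mathcal M$; assume that $K$ is compact. Let $\phi_1,\phi_2$ be maps defined on a set $\mathcal U\subset\mathcal E$ with values in $\mathcal E$, and put $\varphi=\phi_1\circ\phi_2$. Assume that the following hold at every $x\in K$. (A) Clean intersection: there is an open neighbourhood $W$ of $x$ in $\mathcal E$ such that $\mathcal M\cap W$ is a $C^{p,1}$ embedded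 submanifold and $\mathrm T_y\mathcal M=\mathrm T_y\mathcal M_1\cap \mathrm T_y\mathcal M_2$ for all $y\in\mathcal M\cap W$. (B) First-order framework: there is an open neighbourhood $V\subset\mathcal U$ of $x$ such that $\phi_1$ and $\phi_2$ are $C^{p-1}$ on $V$, $\phi_1(V)\subset\mathcal M_1$, and at least one of the following holds: (i) $\phi_1=\mathcal P_{\mathcal M_1}$ on $V$, and $\phi_2$ is first-order consistent with $\mathcal P_{\mathcal M_2}$ on $V$; (ii) $\phi_2=\mathcal P_{\mathcal M_2}$ on $V$, and $\phi_1$ is first-order consistent with $\mathcal P_{\mathcal M_1}$ on $V$; (iii) for both $i=1,2$, $\phi_i$ is first-order consistent with $\mathcal P_{\mathcal M_i}$ on $V$ and $\phi_i(V)\subset\mathcal M_i$. Here $\phi_i$ is called first-order consistent with $\mathcal P_{\mathcal M_i}$ on $V$ if $\|\phi_i(y)-\mathcal P_{\mathcal M_i}(y)\|=o(d_{\mathcal M_i}(y))$ as $y\to z$, for every $z\in V\cap\mathcal M_i$. Then there exist constants $\delta_K>0$, $\rho_K>0$, $\tau_K\in(0,1)$ and $\widehat C_K>0$ such that $\mathcal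 N_{\delta_K}(K)\subset\mathcal U$, such that for every $y\in\mathcal M_1\cap\mathcal N_{\delta_K}(K)$ the point $\varphi(y)$ is well defined and $d_{\mathcal M_2}(\varphi(y))\le\tau_K\,d_{\mathcal M_2}(y)$, and such that the following holds for all $x\in K$ and all $\eta\in\mathrm T_x\mathcal M$ with $\|\eta\|\le\rho_K$. The sequence $x_0=x+\eta$, $x_{k+1}=\varphi(x_k)$ is well defined and converges to a unique limit $x^*=x^*(x,\eta)\in\mathcal M\cap\mathcal N_{\delta_K}(K)$, the projection $\mathcal P_{\mathcal M}(x_0)$ is single-valued, and $$\|x_k-x^*\|\le\widehat C_K\,\tau_K^{\,k}\,\|\eta\|\qquad\text{for all }k\ge0.$$ Moreover, $$\|x^*-\mathcal P_{\mathcal M}(x_0)\|=o(\|\eta\|)\quad\text{as }\eta\to0,\ \text{uniformly in }x\in K.$$ -/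

import Mathlib

open Set Filter Topology

/-- `h` is of class `C^{p,1}` on the open set `U`: it is `p` times continuously differentiable
there and its `p`-th derivative is locally Lipschitz. -/
def IsCp1On {E F : Type*} [NormedAddCommGroup E] [NormedSpace ℝ E]
    [NormedAddCommGroup F] [NormedSpace ℝ F] (p : ℕ) (h : E → F) (U : Set E) : Prop :=
  ContDiffOn ℝ p h U ∧ LocallyLipschitzOn U (iteratedFDeriv ℝ p h)

/-- `h` is a `C^{p,1}` local defining function with `m` components for `M` at `x`, on the open
neighbourhood `U` of `x`. Only the values of `h` on `U` matter. -/
structure IsLocalDefiningFunction {E : Type*} [NormedAddCommGroup E] [NormedSpace ℝ E]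
    (p m : ℕ) (M : Set E) (x : E) (U : Set E) (h : E → EuclideanSpace ℝ (Fin m)) : Prop where
  isOpen : IsOpen U
  mem : x ∈ U
  isCp1 : IsCp1On p h U
  zero_iff : ∀ y ∈ U, h y = 0 ↔ y ∈ M
  surjective : Function.Surjective (fderiv ℝ h x)

/-- `M` is a (non-empty) `C^{p,1}` embedded submanifold of `E`, of some codimension `m`.
For `m = 0` the map `h` takes values in the zero space, so the condition says that `M`
is open. -/
def IsEmbeddedSubmanifold {E : Type*} [NormedAddCommGroup E] [NormedSpace ℝ E]
    (p : ℕ) (M : Set E) : Prop :=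
  M.Nonempty ∧ ∃ m : ℕ, ∀ x ∈ M, ∃ (U : Set E) (h : E → EuclideanSpace ℝ (Fin m)),
    IsLocalDefiningFunction p m M x U h

/-- The tangent space `T_x M`: velocities at time `0` of the curves that run in `M` for
small times, pass through `x` at time `0` and are differentiable there. For an embedded
submanifold with local defining function `h` this is the kernel of `D h(x)`. -/
def tangentVectors {E : Type*} [NormedAddCommGroup E] [NormedSpace ℝ E]
    (M : Set E) (x : E) : Set E :=
  {v | ∃ γ : ℝ → E, γ 0 = x ∧ (∀ᶠ t in 𝓝 (0 : ℝ), γ t ∈ M) ∧ HasDerivAt γ v 0}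

/-- `M₁` and `M₂` intersect cleanly at `x`: near `x` the intersection is a `C^{p,1}` embedded
submanifold whose tangent spaces are the intersections of the tangent spaces. -/
def IntersectCleanlyAt {E : Type*} [NormedAddCommGroup E] [NormedSpace ℝ E]
    (p : ℕ) (M₁ M₂ : Set E) (x : E) : Prop :=
  x ∈ M₁ ∩ M₂ ∧ ∃ W : Set E, IsOpen W ∧ x ∈ W ∧ IsEmbeddedSubmanifold p (M₁ ∩ M₂ ∩ W) ∧
    ∀ y ∈ M₁ ∩ M₂ ∩ W,
      tangentVectors (M₁ ∩ M₂) y = tangentVectors M₁ y ∩ tangentVectors M₂ y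

/-- The (a priori set-valued) orthogonal projection `argmin_{z ∈ D} ‖z - y‖`. -/
def metricProj {E : Type*} [NormedAddCommGroup E] (D : Set E) (y : E) : Set E :=
  {z | z ∈ D ∧ ∀ w ∈ D, ‖z - y‖ ≤ ‖w - y‖}

/-- `f` is the single-valued orthogonal projection onto `D` on the set `V`. -/
def IsProjectionOn {E : Type*} [NormedAddCommGroup E] (f : E → E) (D V : Set E) : Prop :=
  ∀ y ∈ V, metricProj D y = {f y}

/-- First-order consistency of `f` with the projection onto `D` on the open set `V`:
`‖f y - P_D y‖ = o(d_D(y))` as `y → x`, at every `x ∈ V ∩ D`. -/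
def FirstOrderConsistentOn {E : Type*} [NormedAddCommGroup E] (f : E → E) (D V : Set E) : Prop :=
  ∀ x ∈ V ∩ D, ∀ ε > 0, ∀ᶠ y in 𝓝 x, ∀ z ∈ metricProj D y,
    ‖f y - z‖ ≤ ε * Metric.infDist y D

/-- The first-order framework for the pair `(φ₁, φ₂)` on the open set `V`. -/
structure FirstOrderFramework {E : Type*} [NormedAddCommGroup E] [NormedSpace ℝ E]
    (p : ℕ) (M₁ M₂ : Set E) (φ₁ φ₂ : E → E) (V : Set E) : Prop where
  isOpen : IsOpen V
  mapsTo : MapsTo φ₁ V M₁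
  contDiff₁ : ContDiffOn ℝ (p - 1 : ℕ) φ₁ V
  contDiff₂ : ContDiffOn ℝ (p - 1 : ℕ) φ₂ V
  cases :
    (IsProjectionOn φ₁ M₁ V ∧ FirstOrderConsistentOn φ₂ M₂ V) ∨
    (IsProjectionOn φ₂ M₂ V ∧ FirstOrderConsistentOn φ₁ M₁ V) ∨
    ((FirstOrderConsistentOn φ₁ M₁ V ∧ MapsTo φ₁ V M₁) ∧
      (FirstOrderConsistentOn φ₂ M₂ V ∧ MapsTo φ₂ V M₂))

/-!
The argument rests on one property of a submanifold `M` at a point `x`, *strict flatness*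
(`IsStrictlyFlatAt`): for `y` and `z ∈ M` close to `x`, the distance of `y` to `M` equals the
length of the component of `y - z` normal to `T = T_x M`, up to `o(‖y - z‖)`. It follows from the
strict differentiability of a local defining function `h` together with metric regularity, i.e.
`d_M(y) ≤ C ‖h y‖`, which is the quantitative surjectivity behind the inverse function theorem.
Strict flatness says that chords of `M` are almost tangent and that segments to nearest points are
almost normal; it identifies the tangent vectors with `T` and shows that `d_M(x + η) = o(‖η‖)` for
tangent `η`, locally uniformly in `x` (`infDist_add_le_of_mem_tangentVectors`).

In each case of the framework both maps are first-order consistent, so `φᵢ` fixes the points of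
`Mᵢ` and its differential there is the orthogonal projection `Pᵢ` onto the tangent space
(`FirstOrderConsistentOn.hasFDerivAt`). As the maps are `C¹`, the step `φ₁ ∘ φ₂` is strictly
differentiable at `x ∈ M = M₁ ∩ M₂` with differential `P₁ P₂`. In the linear model, `P₁ P₂`
contracts the distance to `T₂` on `T₁` by a factor `c < 1`, and the distance to `T₁ ∩ T₂` is bounded
by the distance to `T₂` there. Clean intersection says that `T₁ ∩ T₂` is the tangent space of `M`,
so strict flatness of `M₁`, `M₂` and `M` transfers these bounds to `y ∈ M₁` near `x`: the step
contracts `d_{M₂}`, and both `d_M(y)` and the length of the step are at most `C d_{M₂}(y)`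
(`StepEstimates.exists_of_hasStrictFDerivAt`). Compactness makes the constants uniform on `K`.

The iterates from the first one on lie in `M₁`, and their steps are dominated by a geometric series
(`StepEstimates.exists_tendsto`); hence they converge linearly to some `x* ∈ M`, with
`‖x₁ - x*‖ ≤ C d_{M₂}(x₁)`. For a nearest point `z` of `x₀ = x + η` in `M`, the step is Lipschitz
and fixes `z`, so `‖x₁ - z‖ ≤ C ‖x₀ - z‖`, and therefore `‖x* - z‖ ≤ C' d_M(x + η) = o(‖η‖)`.

The projection onto `M` is single-valued near `K` because of the `C^{1,1}` regularity of `h`, by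
comparing the midpoint of two nearest points with `M`
(`IsLocalDefiningFunction.exists_metricProj_eq_singleton`).
-/

open Metric

/-! ### Nearest points -/

section General

variable {E : Type*} [NormedAddCommGroup E]

/-- The distance to `D` is attained at every point of `metricProj D y`. -/
lemma infDist_eq_of_mem_metricProj {D : Set E} {y z : E} (hz : z ∈ metricProj D y) :
    infDist y D = ‖z - y‖ := by
  apply le_antisymm
  · rw [← dist_eq_norm, dist_comm]
    exact infDist_le_dist_of_mem hz.1
  · refine (le_infDist ⟨z, hz.1⟩).2 fun w hw => ?_
    rw [dist_comm, dist_eq_norm]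
    exact hz.2 w hw

lemma metricProj_self {D : Set E} {y : E} (hy : y ∈ D) : metricProj D y = {y} := by
  ext z
  constructor
  · intro hz
    have h := hz.2 y hy
    rw [sub_self, norm_zero] at h
    exact sub_eq_zero.1 (norm_le_zero_iff.1 h)
  · rintro rfl
    exact ⟨hy, fun w _ => by simp⟩

/-- Nearest points in a set which is closed near `x` exist for all points near `x`. -/
lemma exists_metricProj_of_isClosed_inter_closedBall [ProperSpace E] {M : Set E} {x : E} {R : ℝ}
    (hx : x ∈ M) (hR : 0 < R) (hcl : IsClosed (closedBall x R ∩ M)) :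
    ∀ y ∈ ball x (R / 2), (metricProj M y).Nonempty := by
  intro y hy
  have hc : IsCompact (closedBall x R ∩ M) :=
    (isCompact_closedBall x R).of_isClosed_subset hcl inter_subset_left
  obtain ⟨w, hw, hmin⟩ := hc.exists_isMinOn ⟨x, mem_closedBall_self hR.le, hx⟩
    (f := fun w => ‖w - y‖) (by fun_prop)
  refine ⟨w, hw.2, fun v hv => ?_⟩
  by_cases hvR : v ∈ closedBall x R
  · exact hmin ⟨hvR, hv⟩
  · have h1 : ‖w - y‖ ≤ ‖x - y‖ := hmin ⟨mem_closedBall_self hR.le, hx⟩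
    rw [mem_ball, dist_eq_norm] at hy
    rw [mem_closedBall, not_le, dist_eq_norm] at hvR
    have h2 : ‖v - x‖ ≤ ‖v - y‖ + ‖y - x‖ := norm_sub_le_norm_sub_add_norm_sub v y x
    rw [norm_sub_rev x y] at h1
    linarith

/-- A nearest point of `y` in `M ∋ x` lies in the ball about `x` of twice the radius. -/
lemma mem_ball_of_mem_metricProj {M : Set E} {x y z : E} {r : ℝ} (hx : x ∈ M)
    (hy : y ∈ ball x (r / 2)) (hz : z ∈ metricProj M y) : z ∈ ball x r := by
  rw [mem_ball, dist_eq_norm] at *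
  have h1 := hz.2 x hx
  have h2 : ‖z - x‖ ≤ ‖z - y‖ + ‖y - x‖ := norm_sub_le_norm_sub_add_norm_sub z y x
  rw [norm_sub_rev x y] at h1
  linarith

end General

/-- The definition of a strict derivative, in terms of balls. -/
lemma HasStrictFDerivAt.exists_ball_norm_le {E F : Type*} [NormedAddCommGroup E] [NormedSpace ℝ E]
    [NormedAddCommGroup F] [NormedSpace ℝ F] {f : E → F} {A : E →L[ℝ] F} {x : E}
    (hf : HasStrictFDerivAt f A x) {ε : ℝ} (hε : 0 < ε) :
    ∃ r > 0, ∀ y ∈ ball x r, ∀ z ∈ ball x r, ‖f y - f z - A (y - z)‖ ≤ ε * ‖y - z‖ := by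
  have h := (hasStrictFDerivAt_iff_isLittleO.1 hf).def hε
  rw [nhds_prod_eq] at h
  obtain ⟨t, ht, h⟩ := eventually_prod_self_iff
    (r := fun y z => ‖f y - f z - A (y - z)‖ ≤ ε * ‖y - z‖).1 h
  obtain ⟨r, hr, hrt⟩ := Metric.mem_nhds_iff.1 ht
  exact ⟨r, hr, fun y hy z hz => h y (hrt hy) z (hrt hz)⟩

/-! ### Local defining functions and strict flatness -/

section DefiningFunction

variable {E : Type*} [NormedAddCommGroup E] [NormedSpace ℝ E]
  {p m : ℕ} {M : Set E} {x : E} {U : Set E} {h : E → EuclideanSpace ℝ (Fin m)}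

/-- A local defining function of `M ∩ W`, where `W` is an open neighbourhood of `x`, is one of
`M` on a smaller neighbourhood. -/
lemma IsLocalDefiningFunction.of_inter {W : Set E}
    (hd : IsLocalDefiningFunction p m (M ∩ W) x U h) (hW : IsOpen W) (hxW : x ∈ W) :
    IsLocalDefiningFunction p m M x (U ∩ W) h where
  isOpen := hd.isOpen.inter hW
  mem := ⟨hd.mem, hxW⟩
  isCp1 := ⟨hd.isCp1.1.mono inter_subset_left, hd.isCp1.2.mono inter_subset_left⟩
  zero_iff := fun y hy => by rw [hd.zero_iff y hy.1]; simp [hy.2]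
  surjective := hd.surjective

namespace IsLocalDefiningFunction

lemma contDiffAt (hd : IsLocalDefiningFunction p m M x U h) {y : E} (hy : y ∈ U) :
    ContDiffAt ℝ p h y :=
  hd.isCp1.1.contDiffAt (hd.isOpen.mem_nhds hy)

lemma hasStrictFDerivAt (hd : IsLocalDefiningFunction p m M x U h) (hp : 2 ≤ p) :
    HasStrictFDerivAt h (fderiv ℝ h x) x :=
  (hd.contDiffAt hd.mem).hasStrictFDerivAt (by
    have : p ≠ 0 := by omega
    exact_mod_cast this)

/-- At the midpoint of two zeros the defining function is of second order in their distance,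
because its differential is Lipschitz. -/
lemma exists_norm_midpoint_le (hd : IsLocalDefiningFunction p m M x U h) (hp : 2 ≤ p) :
    ∃ L ≥ 0, ∃ r > 0, ∀ z ∈ M ∩ ball x r, ∀ z' ∈ M ∩ ball x r,
      ‖h (midpoint ℝ z z')‖ ≤ L * ‖z - z'‖ ^ 2 := by
  have h2 : ContDiffAt ℝ 2 h x := (hd.contDiffAt hd.mem).of_le (by exact_mod_cast hp)
  have h1 : ContDiffAt ℝ 1 (fderiv ℝ h) x := h2.fderiv_right (by norm_num)
  obtain ⟨L, t, ht, hL⟩ := h1.exists_lipschitzOnWith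
  obtain ⟨r, hr, hrt⟩ := Metric.mem_nhds_iff.1
    (Filter.inter_mem ht (hd.isOpen.mem_nhds hd.mem))
  have hdiff : ∀ y ∈ ball x r, DifferentiableAt ℝ h y := fun y hy =>
    (hd.contDiffAt (hrt hy).2).differentiableAt (by
      have : p ≠ 0 := by omega
      exact_mod_cast this)
  -- Taylor's estimate of first order between two points of the ball
  have taylor : ∀ a ∈ ball x r, ∀ b ∈ ball x r,
      ‖h b - h a - fderiv ℝ h a (b - a)‖ ≤ L * ‖b - a‖ * ‖b - a‖ := by
    intro a ha b hb
    have hseg : segment ℝ a b ⊆ ball x r := (convex_ball x r).segment_subset ha hb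
    refine (convex_segment a b).norm_image_sub_le_of_norm_fderiv_le' (𝕜 := ℝ)
      (fun y hy => hdiff y (hseg hy)) (fun y hy => ?_) (left_mem_segment ℝ a b)
      (right_mem_segment ℝ a b)
    rw [← dist_eq_norm]
    refine (hL.dist_le_mul y (hrt (hseg hy)).1 a (hrt ha).1).trans ?_
    gcongr
    rw [dist_comm, norm_sub_rev, ← dist_eq_norm, ← dist_add_dist_of_mem_segment hy]
    exact le_add_of_nonneg_right dist_nonneg
  refine ⟨L, L.coe_nonneg, r, hr, fun z hz z' hz' => ?_⟩
  have hm : midpoint ℝ z z' ∈ ball x r :=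
    (convex_ball x r).segment_subset hz.2 hz'.2 (midpoint_mem_segment z z')
  set a := midpoint ℝ z z' with ha
  have e1 : z - a = (1 / 2 : ℝ) • (z - z') := by
    rw [ha, left_sub_midpoint]; simp
  have e2 : z' - a = -(z - a) := by
    rw [e1, ha, right_sub_midpoint, ← smul_neg, neg_sub]; simp
  have t1 := taylor a hm z hz.2
  have t2 := taylor a hm z' hz'.2
  rw [(hd.zero_iff z (hrt hz.2).2).2 hz.1] at t1
  rw [(hd.zero_iff z' (hrt hz'.2).2).2 hz'.1, e2, map_neg, norm_neg] at t2
  have e3 : (0 - h a - fderiv ℝ h a (z - a)) + (0 - h a - -(fderiv ℝ h a (z - a)))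
      = (-2 : ℝ) • h a := by
    rw [neg_smul, two_smul]; abel
  have t3 := norm_add_le (0 - h a - fderiv ℝ h a (z - a)) (0 - h a - -(fderiv ℝ h a (z - a)))
  rw [e3, norm_smul] at t3
  have e4 : ‖z - a‖ = 1 / 2 * ‖z - z'‖ := by rw [e1, norm_smul]; norm_num
  rw [e4] at t1 t2
  rw [norm_neg, Real.norm_ofNat] at t3
  have : (0 : ℝ) ≤ L * ‖z - z'‖ ^ 2 := by positivity
  nlinarith

end IsLocalDefiningFunction

end DefiningFunction

section FiniteDimensional

variable {E : Type*} [NormedAddCommGroup E] [InnerProductSpace ℝ E] [FiniteDimensional ℝ E]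

/-- `M` is strictly flat at `x` with tangent space `T`: for `y → x` and `z → x`, `z ∈ M`, the
distance of `y` to `M` is the distance of `y` to the affine space `z + T`, up to an error
`o(‖y - z‖)`. -/
def IsStrictlyFlatAt (M : Set E) (x : E) (T : Submodule ℝ E) : Prop :=
  ∀ ε > 0, ∃ r > 0, ∀ y ∈ ball x r, ∀ z ∈ M ∩ ball x r,
    |infDist y M - ‖Tᗮ.starProjection (y - z)‖| ≤ ε * ‖y - z‖

namespace IsLocalDefiningFunction

variable {p m : ℕ} {M : Set E} {x : E} {U : Set E} {h : E → EuclideanSpace ℝ (Fin m)}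

/-- Existence of nearest points near a point of a submanifold, which is locally closed. -/
lemma exists_metricProj (hd : IsLocalDefiningFunction p m M x U h) (hx : x ∈ M) :
    ∃ r > 0, ∀ y ∈ ball x r, (metricProj M y).Nonempty := by
  obtain ⟨R, hR, hRU⟩ := Metric.nhds_basis_closedBall.mem_iff.1 (hd.isOpen.mem_nhds hd.mem)
  refine ⟨R / 2, by positivity, exists_metricProj_of_isClosed_inter_closedBall hx hR ?_⟩
  have : closedBall x R ∩ M = closedBall x R ∩ h ⁻¹' {0} := by
    ext y
    constructor
    · exact fun hy => ⟨hy.1, (hd.zero_iff y (hRU hy.1)).2 hy.2⟩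
    · exact fun hy => ⟨hy.1, (hd.zero_iff y (hRU hy.1)).1 hy.2⟩
  rw [this]
  exact (hd.isCp1.1.continuousOn.mono hRU).preimage_isClosed_of_isClosed isClosed_closedBall
    isClosed_singleton

/-- Metric regularity: near `x` the defining function bounds the distance to `M`. This is the
quantitative surjectivity in the inverse function theorem, applied on balls about `y`. -/
lemma exists_mem_norm_sub_le (hd : IsLocalDefiningFunction p m M x U h) (hp : 2 ≤ p)
    (hx : x ∈ M) :
    ∃ C > 0, ∃ r > 0, ∀ y ∈ ball x r, ∃ w ∈ M, ‖w - y‖ ≤ C * ‖h y‖ := by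
  have hstr := hd.hasStrictFDerivAt hp
  set A := fderiv ℝ h x with hA
  have hsurj : A.range = ⊤ := LinearMap.range_eq_top.2 hd.surjective
  set S := A.nonlinearRightInverseOfSurjective hsurj
  have hS : 0 < S.nnnorm := A.nonlinearRightInverseOfSurjective_nnnorm_pos hsurj
  have hSr : (0 : ℝ) < S.nnnorm := hS
  obtain ⟨s, hs, happ⟩ := hstr.approximates_deriv_on_nhds (c := S.nnnorm⁻¹ / 2)
    (Or.inr (by positivity))
  obtain ⟨R, hR, hRs⟩ := Metric.mem_nhds_iff.1 (Filter.inter_mem hs (hd.isOpen.mem_nhds hd.mem))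
  have hcont : ContinuousAt h x := hstr.continuousAt
  have h0 : h x = 0 := (hd.zero_iff x hd.mem).2 hx
  set C : ℝ := 2 * S.nnnorm with hC
  have hC0 : 0 < C := by positivity
  have hev : ∀ᶠ y in 𝓝 x, C * ‖h y‖ < R / 2 := by
    have : Tendsto (fun y => C * ‖h y‖) (𝓝 x) (𝓝 (C * ‖h x‖)) :=
      (tendsto_const_nhds.mul hcont.norm)
    rw [h0, norm_zero, mul_zero] at this
    exact this.eventually_lt_const (by positivity)
  obtain ⟨r, hr, hrR⟩ := Metric.mem_nhds_iff.1
    (Filter.inter_mem hev (Metric.ball_mem_nhds x (half_pos hR)))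
  refine ⟨C, hC0, r, hr, fun y hy => ?_⟩
  obtain ⟨hy1, hy2⟩ := hrR hy
  have hsub : closedBall y (C * ‖h y‖) ⊆ ball x R := by
    intro w hw
    rw [mem_ball] at *
    rw [mem_closedBall] at hw
    have := dist_triangle w y x
    simp only [mem_ofPred_eq] at hy1
    linarith
  have hsurjOn := happ.surjOn_closedBall_of_nonlinearRightInverse S
    (by positivity : 0 ≤ C * ‖h y‖) (hsub.trans (hRs.trans inter_subset_left))
  have hmem : (0 : EuclideanSpace ℝ (Fin m)) ∈
      closedBall (h y) (((S.nnnorm : ℝ)⁻¹ - ((S.nnnorm⁻¹ / 2 : NNReal) : ℝ)) * (C * ‖h y‖)) := by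
    rw [mem_closedBall, dist_zero_left]
    apply le_of_eq
    rw [hC]
    push_cast
    field_simp
    ring
  obtain ⟨w, hw, hw0⟩ := hsurjOn hmem
  refine ⟨w, (hd.zero_iff w (hRs (hsub hw)).2).1 hw0, ?_⟩
  rwa [mem_closedBall, dist_eq_norm] at hw

/-- A submanifold is strictly flat, with tangent space the kernel of the differential of a
local defining function. -/
lemma isStrictlyFlatAt (hd : IsLocalDefiningFunction p m M x U h) (hp : 2 ≤ p) (hx : x ∈ M) :
    IsStrictlyFlatAt M x (fderiv ℝ h x).ker := by
  intro ε hε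
  have hstr := hd.hasStrictFDerivAt hp
  obtain ⟨C, hC, r₁, hr₁, hreg⟩ := hd.exists_mem_norm_sub_le hp hx
  obtain ⟨r₂, hr₂, hproj⟩ := hd.exists_metricProj hx
  obtain ⟨r₃, hr₃, hU⟩ := Metric.mem_nhds_iff.1 (hd.isOpen.mem_nhds hd.mem)
  set A := fderiv ℝ h x with hA
  set T := A.ker with hT
  have hsurj : A.range = ⊤ := LinearMap.range_eq_top.2 hd.surjective
  set S := A.nonlinearRightInverseOfSurjective hsurj
  obtain ⟨c, hc⟩ : ∃ c : ℝ, c = S.nnnorm := ⟨_, rfl⟩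
  have hc0 : 0 ≤ c := hc ▸ S.nnnorm.coe_nonneg
  -- a right inverse of `A` bounds the component of `v` normal to `T = ker A`
  have hQ : ∀ v : E, ‖Tᗮ.starProjection v‖ ≤ c * ‖A v‖ := by
    intro v
    have h1 : v - S (A v) ∈ T := by
      rw [hT, LinearMap.mem_ker, map_sub, sub_eq_zero]
      exact (S.right_inv (A v)).symm
    have h2 : Tᗮ.starProjection v = Tᗮ.starProjection (S (A v)) := by
      rw [← sub_eq_zero, ← map_sub, Submodule.starProjection_orthogonal_apply_eq_zero h1]
    rw [h2, hc]
    exact (Tᗮ.norm_starProjection_apply_le _).trans (S.bound (A v))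
  have hC' : 0 < C + 2 * c + 1 := by positivity
  obtain ⟨r₄, hr₄, hlin⟩ := hstr.exists_ball_norm_le (div_pos hε hC')
  set ε' := ε / (C + 2 * c + 1) with hε'
  have hε'0 : 0 < ε' := div_pos hε hC'
  have hε'1 : (C + 2 * c) * ε' ≤ ε := by
    have : (C + 2 * c + 1) * ε' = ε := by rw [hε']; field_simp
    nlinarith
  set r := min (min r₁ r₂) (min r₃ r₄) with hr
  have hr0 : 0 < r := by positivity
  have hb : ∀ {ρ}, r ≤ ρ → ball x r ⊆ ball x ρ := fun h => ball_subset_ball h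
  have hrr₁ : r ≤ r₁ := (min_le_left _ _).trans (min_le_left _ _)
  have hrr₂ : r ≤ r₂ := (min_le_left _ _).trans (min_le_right _ _)
  have hrr₃ : r ≤ r₃ := (min_le_right _ _).trans (min_le_left _ _)
  have hrr₄ : r ≤ r₄ := (min_le_right _ _).trans (min_le_right _ _)
  have h0 : ∀ z ∈ M ∩ ball x r, h z = 0 := fun z hz =>
    (hd.zero_iff z (hU (hb hrr₃ hz.2))).2 hz.1
  refine ⟨r / 3, by positivity, fun y hy z hz => ?_⟩
  have hyr : y ∈ ball x r := ball_subset_ball (by linarith) hy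
  have hy2 : y ∈ ball x (r / 2) := ball_subset_ball (by linarith) hy
  have hzr : z ∈ M ∩ ball x r := ⟨hz.1, ball_subset_ball (by linarith) hz.2⟩
  rw [abs_le]
  constructor
  · obtain ⟨w, hw⟩ := hproj y (hb hrr₂ hyr)
    have hwr := mem_ball_of_mem_metricProj hx hy2 hw
    have h1 := hlin w (hb hrr₄ hwr) z (hb hrr₄ hzr.2)
    rw [h0 w ⟨hw.1, hwr⟩, h0 z hzr, sub_zero, zero_sub, norm_neg] at h1
    have h2 : ‖w - z‖ ≤ 2 * ‖y - z‖ := by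
      have h3 := hw.2 z hz.1
      have h4 := norm_sub_le_norm_sub_add_norm_sub w y z
      rw [norm_sub_rev z y] at h3
      linarith
    have h3 : Tᗮ.starProjection (y - z) =
        Tᗮ.starProjection (y - w) + Tᗮ.starProjection (w - z) := by
      rw [← map_add, sub_add_sub_cancel]
    have h4 : ‖Tᗮ.starProjection (y - z)‖ ≤ ‖w - y‖ + c * (ε' * (2 * ‖y - z‖)) := by
      rw [h3, norm_sub_rev w y]
      refine (norm_add_le _ _).trans (add_le_add (Tᗮ.norm_starProjection_apply_le _) ?_)
      exact (hQ _).trans (by gcongr; exact h1.trans (by gcongr))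
    rw [infDist_eq_of_mem_metricProj hw]
    have h5 : (C + 2 * c) * ε' * ‖y - z‖ ≤ ε * ‖y - z‖ := by gcongr
    have h6 : 0 ≤ C * ε' * ‖y - z‖ := by positivity
    linarith
  · -- compare with the point of `z + T` nearest to `y`
    set y' := z + T.starProjection (y - z) with hy'
    have h1 : y' - z = T.starProjection (y - z) := by rw [hy']; abel
    have h2 : y - y' = Tᗮ.starProjection (y - z) := by
      rw [Submodule.starProjection_orthogonal_val, hy']; abel
    have h3 : ‖y' - z‖ ≤ ‖y - z‖ := by rw [h1]; exact T.norm_starProjection_apply_le _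
    have hy'r : y' ∈ ball x r := by
      have hz2 := hz.2
      rw [mem_ball, dist_eq_norm] at hy hz2 ⊢
      have h4 := norm_sub_le_norm_sub_add_norm_sub y' z x
      have h5 := norm_sub_le_norm_sub_add_norm_sub y x z
      rw [norm_sub_rev x z] at h5
      linarith
    have hA0 : A (y' - z) = 0 := by
      rw [h1]
      exact (T.starProjection_apply_mem (y - z) : _ ∈ T)
    have h4 := hlin y' (hb hrr₄ hy'r) z (hb hrr₄ hzr.2)
    rw [h0 z hzr, hA0, sub_zero, sub_zero] at h4
    obtain ⟨w, hw, hwy⟩ := hreg y' (hb hrr₁ hy'r)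
    have h5 : infDist y M ≤ ‖y - w‖ := by
      rw [← dist_eq_norm]; exact infDist_le_dist_of_mem hw
    have h6 := norm_sub_le_norm_sub_add_norm_sub y y' w
    rw [h2, norm_sub_rev y' w] at h6
    have h7 : C * ‖h y'‖ ≤ C * (ε' * ‖y - z‖) := by
      gcongr; exact h4.trans (by gcongr)
    have h8 : (C + 2 * c) * ε' * ‖y - z‖ ≤ ε * ‖y - z‖ := by gcongr
    have h9 : 0 ≤ 2 * c * ε' * ‖y - z‖ := by positivity
    linarith

/-- The projection onto a submanifold is single-valued near each of its points: if `z ≠ z'` were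
two points nearest to `y`, the midpoint of `z` and `z'` would be closer to `y` by an amount of
order `‖z - z'‖ ^ 2 / ‖y - z‖`, while it is at a distance of order `‖z - z'‖ ^ 2` from `M`. -/
lemma exists_metricProj_eq_singleton (hd : IsLocalDefiningFunction p m M x U h) (hp : 2 ≤ p)
    (hx : x ∈ M) : ∃ r > 0, ∀ y ∈ ball x r, ∃ z, metricProj M y = {z} := by
  obtain ⟨C, hC, r₁, hr₁, hreg⟩ := hd.exists_mem_norm_sub_le hp hx
  obtain ⟨r₂, hr₂, hproj⟩ := hd.exists_metricProj hx
  obtain ⟨L, hL, r₃, hr₃, hmid⟩ := hd.exists_norm_midpoint_le hp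
  have hB : 0 < 8 * (C * L) + 1 := by positivity
  set r := min (min (r₁ / 2) r₂) (min (r₃ / 2) (1 / (8 * (C * L) + 1))) with hr
  refine ⟨r, by positivity, fun y hy => ?_⟩
  have hy1 : y ∈ ball x (r₁ / 2) :=
    ball_subset_ball ((min_le_left _ _).trans (min_le_left _ _)) hy
  have hy2 : y ∈ ball x r₂ := ball_subset_ball ((min_le_left _ _).trans (min_le_right _ _)) hy
  have hy3 : y ∈ ball x (r₃ / 2) :=
    ball_subset_ball ((min_le_right _ _).trans (min_le_left _ _)) hy
  have hy4 : y ∈ ball x (1 / (8 * (C * L) + 1)) :=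
    ball_subset_ball ((min_le_right _ _).trans (min_le_right _ _)) hy
  obtain ⟨z, hz⟩ := hproj y hy2
  refine ⟨z, Set.eq_singleton_iff_unique_mem.2 ⟨hz, fun z' hz' => ?_⟩⟩
  have hnorm : ‖z' - y‖ = ‖z - y‖ := le_antisymm (hz'.2 z hz.1) (hz.2 z' hz'.1)
  set ρ := ‖z - y‖ with hρ
  have hρ1 : 8 * (C * L) * ρ < 1 := by
    have h1 : ρ ≤ ‖y - x‖ := by rw [norm_sub_rev]; exact hz.2 x hx
    rw [mem_ball, dist_eq_norm, lt_div_iff₀ hB] at hy4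
    have h2 : 0 ≤ C * L := by positivity
    nlinarith [norm_nonneg (y - x)]
  set a := midpoint ℝ z z' with ha
  have ha1 : a ∈ ball x r₁ := (convex_ball x r₁).segment_subset
    (mem_ball_of_mem_metricProj hx hy1 hz) (mem_ball_of_mem_metricProj hx hy1 hz')
    (midpoint_mem_segment z z')
  have hm := hmid z ⟨hz.1, mem_ball_of_mem_metricProj hx hy3 hz⟩ z'
    ⟨hz'.1, mem_ball_of_mem_metricProj hx hy3 hz'⟩
  obtain ⟨w, hw, hwa⟩ := hreg a ha1
  have h1 : ρ ≤ ‖a - y‖ + C * (L * ‖z - z'‖ ^ 2) := by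
    have h2 := hz.2 w hw
    have h3 := norm_sub_le_norm_sub_add_norm_sub w a y
    have h4 : C * ‖h a‖ ≤ C * (L * ‖z - z'‖ ^ 2) := by gcongr
    linarith
  have h2 : ‖a - y‖ ^ 2 = ρ ^ 2 - ‖z - z'‖ ^ 2 / 4 := by
    have e : a - y = (1 / 2 : ℝ) • ((z - y) + (z' - y)) := by
      rw [ha, midpoint_eq_smul_add, invOf_eq_inv]
      module
    have e' : z - z' = (z - y) - (z' - y) := by abel
    have := parallelogram_law_with_norm ℝ (z - y) (z' - y)
    rw [← e', hnorm] at this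
    rw [e, norm_smul, mul_pow]
    norm_num
    nlinarith
  have h3 : ‖a - y‖ ≤ ρ := by
    apply le_of_sq_le_sq _ (norm_nonneg _)
    rw [h2]; nlinarith [sq_nonneg ‖z - z'‖]
  have h4 : ‖z - z'‖ ^ 2 * (1 / 4 - 2 * (C * L) * ρ) ≤ 0 := by
    have h5 : (ρ - ‖a - y‖) * (ρ + ‖a - y‖) ≤ C * (L * ‖z - z'‖ ^ 2) * (2 * ρ) := by
      apply mul_le_mul <;> first | linarith | positivity
    nlinarith
  have h5 : ‖z - z'‖ ^ 2 ≤ 0 := by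
    by_contra hcon
    have : 0 < ‖z - z'‖ ^ 2 * (1 / 4 - 2 * (C * L) * ρ) :=
      mul_pos (not_le.1 hcon) (by linarith)
    linarith
  have h6 : z - z' = 0 := norm_eq_zero.1 (pow_eq_zero_iff (two_ne_zero) |>.1
    (le_antisymm h5 (sq_nonneg _)))
  exact (sub_eq_zero.1 h6).symm

end IsLocalDefiningFunction

/-! ### Consequences of strict flatness -/

namespace IsStrictlyFlatAt

variable {M : Set E} {x : E} {T : Submodule ℝ E}

/-- Chords of a strictly flat set are almost tangent. -/
lemma norm_orthogonal_le (hM : IsStrictlyFlatAt M x T) {ε : ℝ} (hε : 0 < ε) :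
    ∃ r > 0, ∀ y ∈ M ∩ ball x r, ∀ z ∈ M ∩ ball x r,
      ‖Tᗮ.starProjection (y - z)‖ ≤ ε * ‖y - z‖ := by
  obtain ⟨r, hr, h⟩ := hM ε hε
  refine ⟨r, hr, fun y hy z hz => ?_⟩
  have := h y hy.2 z hz
  rwa [infDist_zero_of_mem hy.1, zero_sub, abs_neg, abs_norm] at this

/-- The segment from a point to a nearest point of a strictly flat set is almost normal:
its normal component has almost the full length. -/
lemma norm_starProjection_le_of_mem_metricProj (hM : IsStrictlyFlatAt M x T) (hx : x ∈ M)
    {ε : ℝ} (hε : 0 < ε) :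
    ∃ r > 0, ∀ y ∈ ball x r, ∀ z ∈ metricProj M y,
      ‖T.starProjection (y - z)‖ ≤ ε * ‖y - z‖ := by
  obtain ⟨r, hr, h⟩ := hM (ε ^ 2 / 2) (by positivity)
  refine ⟨r / 2, by positivity, fun y hy z hz => ?_⟩
  have h1 := h y (ball_subset_ball (by linarith) hy) z
    ⟨hz.1, mem_ball_of_mem_metricProj hx hy hz⟩
  rw [infDist_eq_of_mem_metricProj hz, norm_sub_rev z y] at h1
  have h2 := (abs_le.1 h1).2
  have h3 := Submodule.norm_sq_eq_add_norm_sq_starProjection (y - z) T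
  have h4 := Tᗮ.norm_starProjection_apply_le (y - z)
  apply le_of_sq_le_sq _ (by positivity)
  nlinarith [norm_nonneg (y - z), norm_nonneg (Tᗮ.starProjection (y - z))]

/-- Tangent vectors at points near `x` are almost in `T`. -/
lemma norm_orthogonal_le_of_mem_tangentVectors (hM : IsStrictlyFlatAt M x T) {ε : ℝ}
    (hε : 0 < ε) :
    ∃ r > 0, ∀ z ∈ M ∩ ball x r, ∀ v ∈ tangentVectors M z,
      ‖Tᗮ.starProjection v‖ ≤ ε * ‖v‖ := by
  obtain ⟨r, hr, h⟩ := hM.norm_orthogonal_le hε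
  refine ⟨r, hr, fun z hz v hv => ?_⟩
  obtain ⟨γ, hγ0, hγM, hγ⟩ := hv
  have hslope := hasDerivAt_iff_tendsto_slope.1 hγ
  have hlim1 := ((Tᗮ.starProjection.continuous.tendsto v).comp hslope).norm
  have hlim2 := hslope.norm.const_mul ε
  refine le_of_tendsto_of_tendsto hlim1 hlim2 ?_
  have hball : ∀ᶠ t in 𝓝 (0 : ℝ), γ t ∈ ball x r :=
    hγ.continuousAt.eventually_mem (by rw [hγ0]; exact isOpen_ball.mem_nhds hz.2)
  filter_upwards [hγM.filter_mono nhdsWithin_le_nhds, hball.filter_mono nhdsWithin_le_nhds]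
    with t ht1 ht2
  have h1 := h (γ t) ⟨ht1, ht2⟩ z hz
  simp only [Function.comp_apply, slope_def_module, hγ0, map_smul, norm_smul]
  rw [mul_left_comm]
  gcongr

/-- The tangent space of a strictly flat set is the tangent space of flatness. -/
lemma tangentVectors_eq (hM : IsStrictlyFlatAt M x T) (hx : x ∈ M) :
    tangentVectors M x = T := by
  ext v
  constructor
  · intro hv
    have h0 : ‖Tᗮ.starProjection v‖ ≤ 0 := by
      refine le_of_forall_pos_le_add fun ε hε => ?_
      have hpos : 0 < ‖v‖ + 1 := by positivity
      obtain ⟨r, hr, h⟩ := hM.norm_orthogonal_le_of_mem_tangentVectors (div_pos hε hpos)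
      refine (h x ⟨hx, mem_ball_self hr⟩ v hv).trans ?_
      rw [zero_add, div_mul_eq_mul_div, div_le_iff₀ hpos]
      nlinarith
    have h1 := T.starProjection_add_starProjection_orthogonal v
    rw [norm_le_zero_iff.1 h0, add_zero] at h1
    exact T.starProjection_eq_self_iff.1 h1
  · intro hv
    -- a curve of almost nearest points to `x + t • v`
    have hex : ∀ t : ℝ, ∃ w ∈ M, ‖w - (x + t • v)‖ ≤ infDist (x + t • v) M + t ^ 2 := by
      intro t
      by_cases ht : t = 0
      · exact ⟨x, hx, by simpa [ht] using infDist_nonneg⟩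
      · obtain ⟨w, hw, hlt⟩ := (infDist_lt_iff ⟨x, hx⟩).1
          (lt_add_of_pos_right (infDist (x + t • v) M) (pow_pos (abs_pos.2 ht) 2))
        rw [dist_comm, dist_eq_norm, sq_abs] at hlt
        exact ⟨w, hw, hlt.le⟩
    choose γ hγM hγ using hex
    have hγ0 : γ 0 = x := by
      have := hγ 0
      simp only [zero_smul, add_zero, infDist_zero_of_mem hx] at this
      exact sub_eq_zero.1 (norm_le_zero_iff.1 (by simpa using this))
    refine ⟨γ, hγ0, Eventually.of_forall hγM, ?_⟩
    rw [hasDerivAt_iff_isLittleO, Asymptotics.isLittleO_iff]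
    intro ε hε
    obtain ⟨r, hr, h⟩ := hM (ε / (2 * (‖v‖ + 1))) (by positivity)
    have hev1 : ∀ᶠ t : ℝ in 𝓝 0, x + t • v ∈ ball x r := by
      have hc : ContinuousAt (fun t : ℝ => x + t • v) 0 := by fun_prop
      exact hc.eventually_mem (by simpa using ball_mem_nhds x hr)
    have hev2 : ∀ᶠ t : ℝ in 𝓝 0, |t| < ε / 2 := by
      have hc : ContinuousAt (fun t : ℝ => |t|) 0 := by fun_prop
      exact hc.eventually_lt_const (by simpa using hε)
    filter_upwards [hev1, hev2] with t ht1 ht2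
    have h1 := h _ ht1 x ⟨hx, mem_ball_self hr⟩
    rw [add_sub_cancel_left, map_smul, Submodule.starProjection_orthogonal_apply_eq_zero hv,
      smul_zero, norm_zero, sub_zero, abs_of_nonneg infDist_nonneg, norm_smul,
      Real.norm_eq_abs] at h1
    have h2 : ε / (2 * (‖v‖ + 1)) * (|t| * ‖v‖) ≤ ε / 2 * |t| := by
      have h3 : ε / (2 * (‖v‖ + 1)) * ‖v‖ ≤ ε / 2 := by
        rw [div_mul_eq_mul_div, div_le_div_iff₀ (by positivity) (by positivity)]
        nlinarith
      nlinarith [abs_nonneg t]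
    have h4 : t ^ 2 ≤ ε / 2 * |t| := by
      rw [← sq_abs]; nlinarith [abs_nonneg t]
    have h5 := hγ t
    rw [hγ0, sub_zero, sub_sub, Real.norm_eq_abs]
    linarith

/-- Moving a point of the set by a tangent vector `v` leaves the set only by `o(‖v‖)`, uniformly
near `x`. -/
lemma infDist_add_le_of_mem_tangentVectors (hM : IsStrictlyFlatAt M x T) {ε : ℝ} (hε : 0 < ε) :
    ∃ r > 0, ∀ z ∈ M ∩ ball x r, ∀ v ∈ tangentVectors M z, ‖v‖ ≤ r →
      infDist (z + v) M ≤ ε * ‖v‖ := by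
  obtain ⟨r₁, hr₁, h₁⟩ := hM.norm_orthogonal_le_of_mem_tangentVectors (half_pos hε)
  obtain ⟨r₂, hr₂, h₂⟩ := hM (ε / 2) (half_pos hε)
  set r := min r₁ (r₂ / 2) with hr
  have hrr₁ : r ≤ r₁ := min_le_left _ _
  have hrr₂ : r ≤ r₂ / 2 := min_le_right _ _
  refine ⟨r, by positivity, fun z hz v hv hvr => ?_⟩
  have h3 := h₁ z ⟨hz.1, ball_subset_ball hrr₁ hz.2⟩ v hv
  have hzv : z + v ∈ ball x r₂ := by
    have h4 := hz.2
    rw [mem_ball, dist_eq_norm] at h4 ⊢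
    have h5 := norm_add_le (z - x) v
    rw [sub_add_eq_add_sub] at h5
    linarith
  have h6 := h₂ (z + v) hzv z ⟨hz.1, ball_subset_ball (by linarith) hz.2⟩
  rw [add_sub_cancel_left] at h6
  have h7 := (abs_le.1 h6).2
  linarith

end IsStrictlyFlatAt

/-! ### First-order consistent maps -/

/-- A projection is first-order consistent with itself. -/
lemma IsProjectionOn.firstOrderConsistentOn {F : Type*} [NormedAddCommGroup F] {f : F → F}
    {D V : Set F} (hf : IsProjectionOn f D V) (hV : IsOpen V) : FirstOrderConsistentOn f D V := by
  intro x hx ε hε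
  filter_upwards [hV.mem_nhds hx.1] with y hy z hz
  rw [hf y hy] at hz
  rw [hz, sub_self, norm_zero]
  exact mul_nonneg hε.le infDist_nonneg

namespace FirstOrderConsistentOn

variable {f : E → E} {D V : Set E} {x : E} {T : Submodule ℝ E}

/-- A first-order consistent map fixes the points of the set. -/
lemma apply_eq_self {F : Type*} [NormedAddCommGroup F] {f : F → F} {D V : Set F} {x : F}
    (hf : FirstOrderConsistentOn f D V) (hx : x ∈ V ∩ D) : f x = x := by
  have h := (hf x hx 1 one_pos).self_of_nhds x (by rw [metricProj_self hx.2]; rfl)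
  rw [infDist_zero_of_mem hx.2, mul_zero] at h
  exact sub_eq_zero.1 (norm_le_zero_iff.1 h)

/-- The differential of a first-order consistent map at a point of the set is the orthogonal
projection onto the tangent space: for a nearest point `w` of `y`, the vector `w - x` is almost
tangent and `y - w` is almost normal. -/
lemma hasFDerivAt (hf : FirstOrderConsistentOn f D V) (hx : x ∈ V ∩ D)
    (hD : IsStrictlyFlatAt D x T) (hproj : ∃ r > 0, ∀ y ∈ ball x r, (metricProj D y).Nonempty) :
    HasFDerivAt f T.starProjection x := by
  rw [hasFDerivAt_iff_isLittleO, Asymptotics.isLittleO_iff]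
  intro ε hε
  obtain ⟨r₀, hr₀, hproj⟩ := hproj
  have hε4 : 0 < ε / 4 := by positivity
  obtain ⟨r₁, hr₁, h₁⟩ := hD.norm_orthogonal_le hε4
  obtain ⟨r₂, hr₂, h₂⟩ := hD.norm_starProjection_le_of_mem_metricProj hx.2 hε4
  filter_upwards [ball_mem_nhds x hr₀, ball_mem_nhds x (half_pos hr₁), ball_mem_nhds x hr₂,
    hf x hx _ hε4] with y hy0 hy1 hy2 hy3
  obtain ⟨w, hw⟩ := hproj y hy0
  have h3 := h₁ w ⟨hw.1, mem_ball_of_mem_metricProj hx.2 hy1 hw⟩ x ⟨hx.2, mem_ball_self hr₁⟩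
  have h4 := h₂ y hy2 w hw
  have h5 := hy3 w hw
  rw [infDist_eq_of_mem_metricProj hw] at h5
  have h6 := hw.2 x hx.2
  rw [norm_sub_rev x y] at h6
  have h7 : ‖w - x‖ ≤ 2 * ‖y - x‖ := by
    have := norm_sub_le_norm_sub_add_norm_sub w y x
    linarith
  have e : f y - f x - T.starProjection (y - x) =
      (f y - w) + Tᗮ.starProjection (w - x) - T.starProjection (y - w) := by
    rw [hf.apply_eq_self hx, Submodule.starProjection_orthogonal_val]
    simp only [map_sub]
    abel
  rw [e]
  have h8 := norm_sub_le ((f y - w) + Tᗮ.starProjection (w - x)) (T.starProjection (y - w))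
  have h9 := norm_add_le (f y - w) (Tᗮ.starProjection (w - x))
  rw [norm_sub_rev y w] at h4
  nlinarith

end FirstOrderConsistentOn

namespace FirstOrderFramework

variable {F : Type*} [NormedAddCommGroup F] [NormedSpace ℝ F] {p : ℕ} {M₁ M₂ : Set F}
  {φ₁ φ₂ : F → F} {V : Set F}

lemma consistent₁ (h : FirstOrderFramework p M₁ M₂ φ₁ φ₂ V) : FirstOrderConsistentOn φ₁ M₁ V := by
  rcases h.cases with h' | h' | h'
  exacts [h'.1.firstOrderConsistentOn h.isOpen, h'.2, h'.1.1]

lemma consistent₂ (h : FirstOrderFramework p M₁ M₂ φ₁ φ₂ V) : FirstOrderConsistentOn φ₂ M₂ V := by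
  rcases h.cases with h' | h' | h'
  exacts [h'.2, h'.1.firstOrderConsistentOn h.isOpen, h'.2.1]

end FirstOrderFramework

/-! ### The linear model: composing two orthogonal projections -/

/-- If `T₁` and `T₂` are subspaces, a vector is bounded by its components normal to `T₁`, normal
to `T₂` and tangent to `T₁ ⊓ T₂`. -/
lemma exists_mul_norm_le_norm_starProjection (T₁ T₂ : Submodule ℝ E) :
    ∃ κ > 0, ∀ u : E, κ * ‖u‖ ≤ ‖T₂ᗮ.starProjection u‖ + ‖T₁ᗮ.starProjection u‖ +
      ‖(T₁ ⊓ T₂).starProjection u‖ := by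
  have key : ∀ (T : Submodule ℝ E) (u : E), Tᗮ.starProjection u = 0 → u ∈ T := by
    intro T u hu
    have h1 := T.starProjection_add_starProjection_orthogonal u
    rw [hu, add_zero] at h1
    exact T.starProjection_eq_self_iff.1 h1
  set L : E →L[ℝ] E × E × E :=
    T₂ᗮ.starProjection.prod (T₁ᗮ.starProjection.prod (T₁ ⊓ T₂).starProjection) with hL
  have hker : LinearMap.ker (L : E →ₗ[ℝ] E × E × E) = ⊥ := by
    rw [LinearMap.ker_eq_bot']
    intro u hu
    have hu' : T₂ᗮ.starProjection u = 0 ∧ T₁ᗮ.starProjection u = 0 ∧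
        (T₁ ⊓ T₂).starProjection u = 0 := by
      simpa [hL, Prod.ext_iff] using hu
    rw [← hu'.2.2]
    exact ((T₁ ⊓ T₂).starProjection_eq_self_iff.2 ⟨key _ _ hu'.2.1, key _ _ hu'.1⟩).symm
  obtain ⟨k, hk, hanti⟩ := LinearMap.exists_antilipschitzWith (L : E →ₗ[ℝ] E × E × E) hker
  have hk' : (0 : ℝ) < k := hk
  refine ⟨(k : ℝ)⁻¹, by positivity, fun u => ?_⟩
  have h1 : ‖u‖ ≤ k * ‖L u‖ := by
    simpa using hanti.le_mul_dist u 0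
  have h2 : ‖L u‖ ≤ ‖T₂ᗮ.starProjection u‖ + ‖T₁ᗮ.starProjection u‖ +
      ‖(T₁ ⊓ T₂).starProjection u‖ := by
    have a := norm_nonneg (T₂ᗮ.starProjection u)
    have b := norm_nonneg (T₁ᗮ.starProjection u)
    have c := norm_nonneg ((T₁ ⊓ T₂).starProjection u)
    simp only [hL, ContinuousLinearMap.prod_apply, Prod.norm_mk]
    refine max_le (by linarith) (max_le (by linarith) (by linarith))
  rw [inv_mul_le_iff₀ hk']
  exact h1.trans (by gcongr)

/-- On `T₁`, the composition `P₁ P₂` of the two orthogonal projections contracts the distance to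
`T₂`. With `v` the component of `u` normal to `T₂` one has `Q₂ P₁ P₂ u = v - Q₂ P₁ v`, and
`P₁ v` is not small because `⟪u, P₁ v⟫ = ‖v‖ ^ 2`. -/
lemma exists_norm_starProjection_comp_le_of_mem (T₁ T₂ : Submodule ℝ E) :
    ∃ c : ℝ, 0 ≤ c ∧ c < 1 ∧ ∀ u ∈ T₁,
      ‖T₂ᗮ.starProjection (T₁.starProjection (T₂.starProjection u))‖ ≤
        c * ‖T₂ᗮ.starProjection u‖ := by
  obtain ⟨κ, hκ, h⟩ := exists_mul_norm_le_norm_starProjection T₁ T₂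
  refine ⟨√(1 - κ ^ 2), Real.sqrt_nonneg _, ?_, ?_⟩
  · rw [Real.sqrt_lt' one_pos]
    nlinarith [pow_pos hκ 2]
  intro u hu
  set T := T₁ ⊓ T₂ with hT
  -- only the component `w` of `u` normal to `T` matters
  set w := u - T.starProjection u with hw
  have hTu : T.starProjection u ∈ T := T.starProjection_apply_mem u
  have hw1 : w ∈ T₁ := T₁.sub_mem hu hTu.1
  set v := T₂ᗮ.starProjection u with hv
  have hwv : T₂ᗮ.starProjection w = v := by
    rw [hw, map_sub, Submodule.starProjection_orthogonal_apply_eq_zero hTu.2, sub_zero]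
  have hTw : T.starProjection w = 0 := by
    rw [hw, map_sub, T.starProjection_eq_self_iff.2 hTu, sub_self]
  have h1 : κ * ‖w‖ ≤ ‖v‖ := by
    have := h w
    rwa [hwv, Submodule.starProjection_orthogonal_apply_eq_zero hw1, hTw, norm_zero, add_zero,
      add_zero] at this
  have hP2u : T₂.starProjection u = u - v := by
    rw [hv, Submodule.starProjection_orthogonal_val]; abel
  have hPu : T₂ᗮ.starProjection (T₁.starProjection (T₂.starProjection u)) =
      v - T₂ᗮ.starProjection (T₁.starProjection v) := by
    rw [hP2u, map_sub, map_sub, T₁.starProjection_eq_self_iff.2 hu]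
  have hvv : T₂ᗮ.starProjection v = v :=
    T₂ᗮ.starProjection_eq_self_iff.2 (T₂ᗮ.starProjection_apply_mem u)
  have h2 : ‖v‖ ^ 2 ≤ ‖w‖ * ‖T₁.starProjection v‖ := by
    have e : inner ℝ w (T₁.starProjection v) = ‖v‖ ^ 2 := by
      rw [← Submodule.inner_starProjection_left_eq_right, T₁.starProjection_eq_self_iff.2 hw1]
      conv_lhs => rw [← hvv]
      rw [← Submodule.inner_starProjection_left_eq_right, hwv, real_inner_self_eq_norm_sq]
    rw [← e]
    exact real_inner_le_norm _ _
  have h3 : κ * ‖v‖ ≤ ‖T₁.starProjection v‖ := by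
    rcases (norm_nonneg v).eq_or_lt with h0 | h0
    · rw [← h0, mul_zero]; exact norm_nonneg _
    · have h4 : ‖v‖ * (κ * ‖v‖) ≤ ‖v‖ * ‖T₁.starProjection v‖ := by
        calc ‖v‖ * (κ * ‖v‖) = κ * ‖v‖ ^ 2 := by ring
          _ ≤ κ * (‖w‖ * ‖T₁.starProjection v‖) := by gcongr
          _ = (κ * ‖w‖) * ‖T₁.starProjection v‖ := by ring
          _ ≤ ‖v‖ * ‖T₁.starProjection v‖ := by gcongr
      exact le_of_mul_le_mul_left h4 h0
  have h5 : ‖v - T₂ᗮ.starProjection (T₁.starProjection v)‖ ^ 2 ≤ (1 - κ ^ 2) * ‖v‖ ^ 2 := by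
    have e : inner ℝ v (T₂ᗮ.starProjection (T₁.starProjection v)) =
        ‖T₁.starProjection v‖ ^ 2 := by
      rw [← T₂ᗮ.inner_starProjection_left_eq_right, hvv, ← real_inner_self_eq_norm_sq,
        T₁.inner_starProjection_left_eq_right v,
        T₁.starProjection_eq_self_iff.2 (T₁.starProjection_apply_mem v)]
    have h6 := T₂ᗮ.norm_starProjection_apply_le (T₁.starProjection v)
    have h7 : (κ * ‖v‖) ^ 2 ≤ ‖T₁.starProjection v‖ ^ 2 := by gcongr
    have h8 : ‖T₂ᗮ.starProjection (T₁.starProjection v)‖ ^ 2 ≤ ‖T₁.starProjection v‖ ^ 2 := by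
      gcongr
    rw [norm_sub_sq_real, e]
    nlinarith
  rw [hPu]
  refine (Real.le_sqrt_of_sq_le h5).trans_eq ?_
  rw [Real.sqrt_mul' _ (sq_nonneg _), Real.sqrt_sq (norm_nonneg _)]

/-- The contraction estimate for vectors that are only approximately in `T₁`. -/
lemma exists_norm_starProjection_comp_le (T₁ T₂ : Submodule ℝ E) :
    ∃ c : ℝ, 0 ≤ c ∧ c < 1 ∧ ∀ u : E,
      ‖T₂ᗮ.starProjection (T₁.starProjection (T₂.starProjection u))‖ ≤
        c * ‖T₂ᗮ.starProjection u‖ + 2 * ‖T₁ᗮ.starProjection u‖ := by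
  obtain ⟨c, hc0, hc1, h⟩ := exists_norm_starProjection_comp_le_of_mem T₁ T₂
  refine ⟨c, hc0, hc1, fun u => ?_⟩
  set n := T₁ᗮ.starProjection u with hn
  set a := T₁.starProjection u with ha
  have hu : a + n = u := T₁.starProjection_add_starProjection_orthogonal u
  have h1 := h a (T₁.starProjection_apply_mem u)
  have h2 : ‖T₂ᗮ.starProjection (T₁.starProjection (T₂.starProjection n))‖ ≤ ‖n‖ :=
    (T₂ᗮ.norm_starProjection_apply_le _).trans
      ((T₁.norm_starProjection_apply_le _).trans (T₂.norm_starProjection_apply_le _))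
  have h3 : ‖T₂ᗮ.starProjection a‖ ≤ ‖T₂ᗮ.starProjection u‖ + ‖n‖ := by
    have e : T₂ᗮ.starProjection a = T₂ᗮ.starProjection u - T₂ᗮ.starProjection n := by
      rw [← map_sub, ← hu, add_sub_cancel_right]
    rw [e]
    exact (norm_sub_le _ _).trans (by gcongr; exact T₂ᗮ.norm_starProjection_apply_le n)
  have h4 : ‖T₂ᗮ.starProjection (T₁.starProjection (T₂.starProjection u))‖ ≤
      ‖T₂ᗮ.starProjection (T₁.starProjection (T₂.starProjection a))‖ + ‖n‖ := by
    conv_lhs => rw [← hu, map_add, map_add, map_add]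
    exact (norm_add_le _ _).trans (by gcongr)
  nlinarith [norm_nonneg n]

/-! ### Uniform estimates for one step of the iteration -/

/-- Quantitative properties of the step `y ↦ φ₁ (φ₂ y)` on the balls of radius `δ` about the
points of `s`, with contraction factor `τ` and constant `C`. -/
structure StepEstimates {F : Type*} [NormedAddCommGroup F] (M₁ M₂ U : Set F) (φ₁ φ₂ : F → F)
    (s : Set F) (δ τ C : ℝ) : Prop where
  mem : ∀ x ∈ s, ∀ y ∈ ball x δ, y ∈ U ∧ φ₂ y ∈ U ∧ φ₁ (φ₂ y) ∈ M₁
  single_valued : ∀ x ∈ s, ∀ y ∈ ball x δ, ∃ z, metricProj (M₁ ∩ M₂) y = {z}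
  norm_sub_le : ∀ x ∈ s, ∀ y ∈ ball x δ, ∀ z ∈ M₁ ∩ M₂ ∩ ball x δ,
    ‖φ₁ (φ₂ y) - z‖ ≤ C * ‖y - z‖
  contracts : ∀ x ∈ s, ∀ y ∈ M₁ ∩ ball x δ, infDist (φ₁ (φ₂ y)) M₂ ≤ τ * infDist y M₂
  infDist_le : ∀ x ∈ s, ∀ y ∈ M₁ ∩ ball x δ, infDist y (M₁ ∩ M₂) ≤ C * infDist y M₂
  norm_step_le : ∀ x ∈ s, ∀ y ∈ M₁ ∩ ball x δ, ‖φ₁ (φ₂ y) - y‖ ≤ C * infDist y M₂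

namespace StepEstimates

section NormedGroup

variable {F : Type*} [NormedAddCommGroup F] {M₁ M₂ U : Set F} {φ₁ φ₂ : F → F} {s : Set F}
  {δ τ C : ℝ}

/-- Estimates persist on families of smaller balls, with worse constants. -/
lemma mono (h : StepEstimates M₁ M₂ U φ₁ φ₂ s δ τ C) {t : Set F} {δ' τ' C' : ℝ}
    (ht : ∀ x' ∈ t, ∃ x ∈ s, ball x' δ' ⊆ ball x δ) (hτ : τ ≤ τ') (hC : C ≤ C') :
    StepEstimates M₁ M₂ U φ₁ φ₂ t δ' τ' C' := by
  constructor
  · intro x' hx' y hy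
    obtain ⟨x, hx, hb⟩ := ht x' hx'
    exact h.mem x hx y (hb hy)
  · intro x' hx' y hy
    obtain ⟨x, hx, hb⟩ := ht x' hx'
    exact h.single_valued x hx y (hb hy)
  · intro x' hx' y hy z hz
    obtain ⟨x, hx, hb⟩ := ht x' hx'
    exact (h.norm_sub_le x hx y (hb hy) z ⟨hz.1, hb hz.2⟩).trans (by gcongr)
  · intro x' hx' y hy
    obtain ⟨x, hx, hb⟩ := ht x' hx'
    exact (h.contracts x hx y ⟨hy.1, hb hy.2⟩).trans
      (mul_le_mul_of_nonneg_right hτ infDist_nonneg)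
  · intro x' hx' y hy
    obtain ⟨x, hx, hb⟩ := ht x' hx'
    exact (h.infDist_le x hx y ⟨hy.1, hb hy.2⟩).trans
      (mul_le_mul_of_nonneg_right hC infDist_nonneg)
  · intro x' hx' y hy
    obtain ⟨x, hx, hb⟩ := ht x' hx'
    exact (h.norm_step_le x hx y ⟨hy.1, hb hy.2⟩).trans
      (mul_le_mul_of_nonneg_right hC infDist_nonneg)

lemma union (h : StepEstimates M₁ M₂ U φ₁ φ₂ s δ τ C) {t : Set F}
    (h' : StepEstimates M₁ M₂ U φ₁ φ₂ t δ τ C) :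
    StepEstimates M₁ M₂ U φ₁ φ₂ (s ∪ t) δ τ C where
  mem x hx := hx.elim (h.mem x) (h'.mem x)
  single_valued x hx := hx.elim (h.single_valued x) (h'.single_valued x)
  norm_sub_le x hx := hx.elim (h.norm_sub_le x) (h'.norm_sub_le x)
  contracts x hx := hx.elim (h.contracts x) (h'.contracts x)
  infDist_le x hx := hx.elim (h.infDist_le x) (h'.infDist_le x)
  norm_step_le x hx := hx.elim (h.norm_step_le x) (h'.norm_step_le x)

/-- Local estimates at the points of a compact set hold uniformly on the compact set. -/
lemma exists_of_isCompact {K : Set F} (hK : IsCompact K)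
    (hloc : ∀ x ∈ K, ∃ δ > 0, ∃ τ ∈ Ioo (0 : ℝ) 1, ∃ C > 0,
      StepEstimates M₁ M₂ U φ₁ φ₂ {x} δ τ C) :
    ∃ δ > 0, ∃ τ ∈ Ioo (0 : ℝ) 1, ∃ C > 0, StepEstimates M₁ M₂ U φ₁ φ₂ K δ τ C := by
  refine hK.induction_on (p := fun s => ∃ δ > 0, ∃ τ ∈ Ioo (0 : ℝ) 1, ∃ C > 0,
      StepEstimates M₁ M₂ U φ₁ φ₂ s δ τ C) ?_ ?_ ?_ ?_
  · exact ⟨1, one_pos, 1 / 2, by norm_num, 1, one_pos, by constructor <;> simp⟩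
  · rintro s t hst ⟨δ, hδ, τ, hτ, C, hC, h⟩
    exact ⟨δ, hδ, τ, hτ, C, hC, h.mono (fun x hx => ⟨x, hst hx, Subset.rfl⟩) le_rfl le_rfl⟩
  · rintro s t ⟨δ, hδ, τ, hτ, C, hC, h⟩ ⟨δ', hδ', τ', hτ', C', hC', h'⟩
    refine ⟨min δ δ', lt_min hδ hδ', max τ τ', ⟨lt_max_of_lt_left hτ.1, max_lt hτ.2 hτ'.2⟩,
      max C C', lt_max_of_lt_left hC, union ?_ ?_⟩
    · exact h.mono (fun x hx => ⟨x, hx, ball_subset_ball (min_le_left _ _)⟩) (le_max_left _ _)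
        (le_max_left _ _)
    · exact h'.mono (fun x hx => ⟨x, hx, ball_subset_ball (min_le_right _ _)⟩) (le_max_right _ _)
        (le_max_right _ _)
  · intro x hx
    obtain ⟨δ, hδ, τ, hτ, C, hC, h⟩ := hloc x hx
    refine ⟨ball x (δ / 2), mem_nhdsWithin_of_mem_nhds (ball_mem_nhds x (half_pos hδ)), δ / 2,
      half_pos hδ, τ, hτ, C, hC, h.mono (fun x' hx' => ⟨x, rfl, ?_⟩) le_rfl le_rfl⟩
    apply ball_subset_ball'
    rw [mem_ball] at hx'
    linarith

/-- A sequence of iterates that starts in `M₁`, close enough to a point of `s` and to `M₂`, stays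
near that point and converges linearly to a point of `M₁ ∩ M₂`: the steps are dominated by a
geometric series. -/
lemma exists_tendsto [CompleteSpace F] (h : StepEstimates M₁ M₂ U φ₁ φ₂ s δ τ C)
    (hτ : τ ∈ Ioo (0 : ℝ) 1) (hC : 0 < C) {x y : F} (hx : x ∈ s) (hyM : y ∈ M₁)
    (hy : dist y x + C / (1 - τ) * infDist y M₂ < δ) :
    (∀ k : ℕ, (φ₁ ∘ φ₂)^[k] y ∈ ball x δ) ∧ ∃ l ∈ M₁ ∩ M₂ ∩ ball x δ,
      Tendsto (fun k : ℕ => (φ₁ ∘ φ₂)^[k] y) atTop (𝓝 l) ∧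
      ∀ k : ℕ, ‖(φ₁ ∘ φ₂)^[k] y - l‖ ≤ C / (1 - τ) * τ ^ k * infDist y M₂ := by
  have hτ1 : 0 < 1 - τ := sub_pos.2 hτ.2
  have hτ0 : 0 < τ := hτ.1
  set d := infDist y M₂ with hd
  have hd0 : 0 ≤ d := infDist_nonneg
  have ball_of : ∀ k : ℕ, ∀ w : F, dist w x ≤ dist y x + C * ((1 - τ ^ k) / (1 - τ)) * d →
      w ∈ ball x δ := by
    intro k w hw
    rw [mem_ball]
    refine lt_of_le_of_lt (hw.trans ?_) hy
    have : (1 - τ ^ k) / (1 - τ) ≤ 1 / (1 - τ) := by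
      gcongr
      linarith [pow_nonneg hτ0.le k]
    rw [div_eq_mul_one_div C]
    gcongr
  have inv : ∀ k : ℕ, (φ₁ ∘ φ₂)^[k] y ∈ M₁ ∧ infDist ((φ₁ ∘ φ₂)^[k] y) M₂ ≤ τ ^ k * d ∧
      dist ((φ₁ ∘ φ₂)^[k] y) x ≤ dist y x + C * ((1 - τ ^ k) / (1 - τ)) * d := by
    intro k
    induction k with
    | zero => simp [hyM, hd]
    | succ k ih =>
      obtain ⟨h1, h2, h3⟩ := ih
      have hb := ball_of k _ h3
      rw [Function.iterate_succ_apply']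
      set w := (φ₁ ∘ φ₂)^[k] y
      refine ⟨(h.mem x hx w hb).2.2, (h.contracts x hx w ⟨h1, hb⟩).trans ?_, ?_⟩
      · rw [pow_succ', mul_assoc]
        gcongr
      · have h4 := h.norm_step_le x hx w ⟨h1, hb⟩
        rw [← dist_eq_norm] at h4
        have h5 : C * infDist w M₂ ≤ C * (τ ^ k * d) := by gcongr
        have h6 := dist_triangle (φ₁ (φ₂ w)) w x
        have h7 : C * ((1 - τ ^ (k + 1)) / (1 - τ)) * d =
            C * (τ ^ k * d) + C * ((1 - τ ^ k) / (1 - τ)) * d := by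
          field_simp
          ring
        simp only [Function.comp_apply]
        linarith
  have hball : ∀ k : ℕ, (φ₁ ∘ φ₂)^[k] y ∈ ball x δ := fun k => ball_of k _ (inv k).2.2
  have hstep : ∀ k : ℕ, dist ((φ₁ ∘ φ₂)^[k] y) ((φ₁ ∘ φ₂)^[k + 1] y) ≤ C * d * τ ^ k := by
    intro k
    rw [Function.iterate_succ_apply', dist_comm, dist_eq_norm]
    refine (h.norm_step_le x hx _ ⟨(inv k).1, hball k⟩).trans ?_
    calc C * infDist ((φ₁ ∘ φ₂)^[k] y) M₂ ≤ C * (τ ^ k * d) := by gcongr; exact (inv k).2.1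
      _ = C * d * τ ^ k := by ring
  obtain ⟨l, hl⟩ := cauchySeq_tendsto_of_complete (cauchySeq_of_le_geometric τ _ hτ.2 hstep)
  have hrate : ∀ k : ℕ, ‖(φ₁ ∘ φ₂)^[k] y - l‖ ≤ C / (1 - τ) * τ ^ k * d := by
    intro k
    rw [← dist_eq_norm]
    refine (dist_le_of_le_geometric_of_tendsto τ _ hτ.2 hstep hl k).trans_eq ?_
    field_simp
  have hlx : l ∈ ball x δ := by
    rw [mem_ball]
    have h1 := hrate 0
    rw [Function.iterate_zero_apply, pow_zero, mul_one, ← dist_eq_norm, dist_comm] at h1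
    have h2 := dist_triangle l y x
    linarith
  refine ⟨hball, l, ⟨?_, hlx⟩, hl, hrate⟩
  obtain ⟨z, hz⟩ := h.single_valued x hx l hlx
  have hz' : z ∈ metricProj (M₁ ∩ M₂) l := by rw [hz]; rfl
  have h0 : infDist l (M₁ ∩ M₂) ≤ 0 := by
    have ht1 : Tendsto (fun k : ℕ => infDist ((φ₁ ∘ φ₂)^[k] y) (M₁ ∩ M₂)) atTop
        (𝓝 (infDist l (M₁ ∩ M₂))) := ((continuous_infDist_pt _).tendsto l).comp hl
    have ht2 : Tendsto (fun k : ℕ => C * (τ ^ k * d)) atTop (𝓝 (C * (0 * d))) :=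
      ((tendsto_pow_atTop_nhds_zero_of_lt_one hτ0.le hτ.2).mul_const d).const_mul C
    rw [zero_mul, mul_zero] at ht2
    refine le_of_tendsto_of_tendsto' ht1 ht2 fun k => ?_
    refine (h.infDist_le x hx _ ⟨(inv k).1, hball k⟩).trans ?_
    gcongr
    exact (inv k).2.1
  rw [infDist_eq_of_mem_metricProj hz'] at h0
  rw [← sub_eq_zero.1 (norm_le_zero_iff.1 h0)]
  exact hz'.1

end NormedGroup

/-- The estimates near a point of clean intersection: there `φ₁ ∘ φ₂` is strictly differentiable
with differential the composition of the projections onto the tangent spaces, so that the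
contraction of the linear model carries over. -/
lemma exists_of_hasStrictFDerivAt {M₁ M₂ U : Set E} {φ₁ φ₂ : E → E} {x : E}
    {T₁ T₂ : Submodule ℝ E} (hx : x ∈ M₁ ∩ M₂)
    (h₁ : IsStrictlyFlatAt M₁ x T₁) (h₂ : IsStrictlyFlatAt M₂ x T₂)
    (hM : IsStrictlyFlatAt (M₁ ∩ M₂) x (T₁ ⊓ T₂))
    (hproj : ∃ r > 0, ∀ y ∈ ball x r, ∃ z, metricProj (M₁ ∩ M₂) y = {z})
    (hmem : ∀ᶠ y in 𝓝 x, y ∈ U ∧ φ₂ y ∈ U ∧ φ₁ (φ₂ y) ∈ M₁)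
    (hfix : ∀ᶠ y in 𝓝 x, y ∈ M₁ ∩ M₂ → φ₁ (φ₂ y) = y)
    (hφ : HasStrictFDerivAt (φ₁ ∘ φ₂) (T₁.starProjection ∘L T₂.starProjection) x) :
    ∃ δ > 0, ∃ τ ∈ Ioo (0 : ℝ) 1, ∃ C > 0, StepEstimates M₁ M₂ U φ₁ φ₂ {x} δ τ C := by
  obtain ⟨κ, hκ, hlow⟩ := exists_mul_norm_le_norm_starProjection T₁ T₂
  obtain ⟨c, hc0, hc1, hcon⟩ := exists_norm_starProjection_comp_le T₁ T₂
  -- the admissible relative error of the linearization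
  obtain ⟨e, he, he1, heκ⟩ : ∃ e > 0, e ≤ 1 ∧ e ≤ κ * (1 - c) / 24 :=
    ⟨min 1 (κ * (1 - c) / 24), lt_min one_pos (by have := sub_pos.2 hc1; positivity),
      min_le_left _ _, min_le_right _ _⟩
  obtain ⟨r₁, hr₁, hA1⟩ := h₁.norm_orthogonal_le he
  obtain ⟨r₂, hr₂, hA2⟩ := h₂ e he
  obtain ⟨r₃, hr₃, hA3⟩ := hM.norm_starProjection_le_of_mem_metricProj hx he
  obtain ⟨r₄, hr₄, hA4⟩ := hφ.exists_ball_norm_le he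
  obtain ⟨r₅, hr₅, hA5⟩ := hproj
  obtain ⟨r₆, hr₆, hA6⟩ := Metric.mem_nhds_iff.1 (hmem.and hfix)
  obtain ⟨r, hr, hrr₁, hrr₂, hrr₃, hrr₄, hrr₅, hrr₆⟩ : ∃ r > 0, r ≤ r₁ ∧ r ≤ r₂ ∧ r ≤ r₃ ∧
      r ≤ r₄ ∧ r ≤ r₅ ∧ r ≤ r₆ :=
    ⟨min r₁ (min r₂ (min r₃ (min r₄ (min r₅ r₆)))), by positivity, by simp⟩
  have hlip : ∀ y ∈ ball x r, ∀ z ∈ M₁ ∩ M₂ ∩ ball x r, ‖φ₁ (φ₂ y) - z‖ ≤ 2 * ‖y - z‖ := by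
    intro y hy z hz
    have h3 := hA4 y (ball_subset_ball hrr₄ hy) z (ball_subset_ball hrr₄ hz.2)
    simp only [Function.comp_apply, ContinuousLinearMap.comp_apply] at h3
    rw [(hA6 (ball_subset_ball hrr₆ hz.2)).2 hz.1] at h3
    have h4 : ‖T₁.starProjection (T₂.starProjection (y - z))‖ ≤ ‖y - z‖ :=
      (T₁.norm_starProjection_apply_le _).trans (T₂.norm_starProjection_apply_le _)
    have h5 := norm_le_norm_sub_add (φ₁ (φ₂ y) - z) (T₁.starProjection (T₂.starProjection (y - z)))
    nlinarith [norm_nonneg (y - z)]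
  -- the estimates in terms of the distance to a nearest point of `M₁ ∩ M₂`
  have main : ∀ y ∈ M₁ ∩ ball x (r / 2), ∃ z ∈ metricProj (M₁ ∩ M₂) y,
      κ * ‖y - z‖ ≤ 2 * infDist y M₂ ∧ ‖φ₁ (φ₂ y) - z‖ ≤ 2 * ‖y - z‖ ∧
      infDist (φ₁ (φ₂ y)) M₂ ≤ c * infDist y M₂ + 6 * e * ‖y - z‖ := by
    intro y hy
    have hyr : y ∈ ball x r := ball_subset_ball (by linarith) hy.2
    obtain ⟨z, hz⟩ := hA5 y (ball_subset_ball hrr₅ hyr)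
    have hz : z ∈ metricProj (M₁ ∩ M₂) y := by rw [hz]; rfl
    have hzr := mem_ball_of_mem_metricProj hx hy.2 hz
    have hφy := hlip y hyr z ⟨hz.1, hzr⟩
    have hφr : φ₁ (φ₂ y) ∈ ball x r := by
      have h3 := hlip y hyr x ⟨hx, mem_ball_self hr⟩
      have h4 := hy.2
      rw [mem_ball, dist_eq_norm] at h4 ⊢
      linarith
    have b1 := hA1 y ⟨hy.1, ball_subset_ball hrr₁ hyr⟩ z ⟨hz.1.1, ball_subset_ball hrr₁ hzr⟩
    have b2 := abs_le.1
      (hA2 y (ball_subset_ball hrr₂ hyr) z ⟨hz.1.2, ball_subset_ball hrr₂ hzr⟩)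
    have b3 := (abs_le.1
      (hA2 _ (ball_subset_ball hrr₂ hφr) z ⟨hz.1.2, ball_subset_ball hrr₂ hzr⟩)).2
    have b4 := hA3 y (ball_subset_ball hrr₃ hyr) z hz
    have b5 := hA4 y (ball_subset_ball hrr₄ hyr) z (ball_subset_ball hrr₄ hzr)
    simp only [Function.comp_apply, ContinuousLinearMap.comp_apply] at b5
    rw [(hA6 (ball_subset_ball hrr₆ hzr)).2 hz.1] at b5
    have b6 := hlow (y - z)
    have b7 := hcon (y - z)
    have hu : 0 ≤ ‖y - z‖ := norm_nonneg _
    refine ⟨z, hz, ?_, hφy, ?_⟩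
    · have h3 : 6 * e * ‖y - z‖ ≤ κ * ‖y - z‖ := by
        apply mul_le_mul_of_nonneg_right _ hu
        nlinarith
      linarith [b2.1]
    · have h3 : ‖T₂ᗮ.starProjection (φ₁ (φ₂ y) - z)‖ ≤ e * ‖y - z‖ +
          ‖T₂ᗮ.starProjection (T₁.starProjection (T₂.starProjection (y - z)))‖ := by
        have h4 := norm_le_norm_sub_add (T₂ᗮ.starProjection (φ₁ (φ₂ y) - z))
          (T₂ᗮ.starProjection (T₁.starProjection (T₂.starProjection (y - z))))
        rw [← map_sub] at h4
        have h5 := T₂ᗮ.norm_starProjection_apply_le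
          (φ₁ (φ₂ y) - z - T₁.starProjection (T₂.starProjection (y - z)))
        linarith
      have h4 : e * ‖φ₁ (φ₂ y) - z‖ ≤ e * (2 * ‖y - z‖) := by gcongr
      have h5 : c * ‖T₂ᗮ.starProjection (y - z)‖ ≤ c * (infDist y M₂ + e * ‖y - z‖) := by
        gcongr
        linarith [b2.1]
      have h6 : c * (e * ‖y - z‖) ≤ 1 * (e * ‖y - z‖) := by gcongr
      linarith
  have hC2 : 2 ≤ 2 + 6 / κ := by
    have : 0 < 6 / κ := by positivity
    linarith
  have hsub : ball x (r / 2) ⊆ ball x r := ball_subset_ball (by linarith)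
  refine ⟨r / 2, half_pos hr, (1 + c) / 2, ⟨by linarith, by linarith⟩, 2 + 6 / κ, by linarith,
    ?_⟩
  constructor
  · rintro _ rfl y hy
    exact (hA6 (ball_subset_ball hrr₆ (hsub hy))).1
  · rintro _ rfl y hy
    exact hA5 y (ball_subset_ball hrr₅ (hsub hy))
  · rintro _ rfl y hy z hz
    exact (hlip y (hsub hy) z ⟨hz.1, hsub hz.2⟩).trans (by gcongr)
  · rintro _ rfl y hy
    obtain ⟨z, -, h3, -, h5⟩ := main y hy
    have h6 : 6 * e * ‖y - z‖ ≤ (1 - c) / 4 * (κ * ‖y - z‖) := by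
      rw [← mul_assoc]
      exact mul_le_mul_of_nonneg_right (by linarith) (norm_nonneg _)
    have h7 : (1 - c) / 4 * (κ * ‖y - z‖) ≤ (1 - c) / 4 * (2 * infDist y M₂) := by
      have := sub_pos.2 hc1
      gcongr
    linarith
  · rintro _ rfl y hy
    obtain ⟨z, hz, h3, -, -⟩ := main y hy
    rw [infDist_eq_of_mem_metricProj hz, norm_sub_rev, add_mul, div_mul_eq_mul_div]
    have h4 : ‖y - z‖ ≤ 6 * infDist y M₂ / κ := by
      rw [le_div_iff₀ hκ]
      linarith [infDist_nonneg (x := y) (s := M₂)]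
    linarith [infDist_nonneg (x := y) (s := M₂)]
  · rintro _ rfl y hy
    obtain ⟨z, -, h3, h4, -⟩ := main y hy
    have h5 : ‖y - z‖ * 3 ≤ 6 * infDist y M₂ / κ := by
      rw [le_div_iff₀ hκ]
      linarith
    have h6 := norm_sub_le_norm_sub_add_norm_sub (φ₁ (φ₂ y)) z y
    rw [norm_sub_rev z y] at h6
    rw [add_mul, div_mul_eq_mul_div]
    linarith [infDist_nonneg (x := y) (s := M₂)]

/-- The estimates near a point where the first-order framework holds and the intersection is
clean. -/
lemma exists_of_framework {p : ℕ} (hp : 2 ≤ p) {M₁ M₂ U V : Set E} {φ₁ φ₂ : E → E} {x : E}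
    (hM₁ : IsEmbeddedSubmanifold p M₁) (hM₂ : IsEmbeddedSubmanifold p M₂)
    (hclean : IntersectCleanlyAt p M₁ M₂ x) (hVU : V ⊆ U) (hxV : x ∈ V)
    (hφ : FirstOrderFramework p M₁ M₂ φ₁ φ₂ V) :
    (∃ T : Submodule ℝ E, IsStrictlyFlatAt (M₁ ∩ M₂) x T) ∧
    ∃ δ > 0, ∃ τ ∈ Ioo (0 : ℝ) 1, ∃ C > 0, StepEstimates M₁ M₂ U φ₁ φ₂ {x} δ τ C := by
  obtain ⟨hx, W, hW, hxW, ⟨-, m, hdef⟩, htan⟩ := hclean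
  obtain ⟨O, h, hd⟩ := hdef x ⟨hx, hxW⟩
  have hd := hd.of_inter hW hxW
  obtain ⟨m₁, hdef₁⟩ := hM₁.2
  obtain ⟨O₁, g₁, hd₁⟩ := hdef₁ x hx.1
  obtain ⟨m₂, hdef₂⟩ := hM₂.2
  obtain ⟨O₂, g₂, hd₂⟩ := hdef₂ x hx.2
  have hf₁ := hd₁.isStrictlyFlatAt hp hx.1
  have hf₂ := hd₂.isStrictlyFlatAt hp hx.2
  have hf := hd.isStrictlyFlatAt hp hx
  set T₁ := (fderiv ℝ g₁ x).ker
  set T₂ := (fderiv ℝ g₂ x).ker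
  have hT : (fderiv ℝ h x).ker = T₁ ⊓ T₂ := by
    apply SetLike.coe_injective
    rw [Submodule.coe_inf, ← hf.tangentVectors_eq hx, ← hf₁.tangentVectors_eq hx.1,
      ← hf₂.tangentVectors_eq hx.2]
    exact htan x ⟨hx, hxW⟩
  rw [hT] at hf
  have hV := hφ.isOpen.mem_nhds hxV
  have hp1 : ((p - 1 : ℕ) : WithTop ℕ∞) ≠ 0 := by
    have : p - 1 ≠ 0 := by omega
    exact_mod_cast this
  have hφ₂x : φ₂ x = x := hφ.consistent₂.apply_eq_self ⟨hxV, hx.2⟩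
  have hs₁ : HasStrictFDerivAt φ₁ T₁.starProjection x :=
    (hφ.contDiff₁.contDiffAt hV).hasStrictFDerivAt'
      (hφ.consistent₁.hasFDerivAt ⟨hxV, hx.1⟩ hf₁ (hd₁.exists_metricProj hx.1)) hp1
  have hs₂ : HasStrictFDerivAt φ₂ T₂.starProjection x :=
    (hφ.contDiff₂.contDiffAt hV).hasStrictFDerivAt'
      (hφ.consistent₂.hasFDerivAt ⟨hxV, hx.2⟩ hf₂ (hd₂.exists_metricProj hx.2)) hp1
  have hs₁' : HasStrictFDerivAt φ₁ T₁.starProjection (φ₂ x) := by rwa [hφ₂x]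
  have hs : HasStrictFDerivAt (φ₁ ∘ φ₂) (T₁.starProjection ∘L T₂.starProjection) x :=
    hs₁'.comp x hs₂
  have hev : ∀ᶠ y in 𝓝 x, φ₂ y ∈ V :=
    hs₂.continuousAt.eventually_mem (by rwa [hφ₂x])
  refine ⟨⟨_, hf⟩, exists_of_hasStrictFDerivAt hx hf₁ hf₂ hf
    (hd.exists_metricProj_eq_singleton hp hx) ?_ ?_ hs⟩
  · filter_upwards [hV, hev] with y hy1 hy2
    exact ⟨hVU hy1, hVU hy2, hφ.mapsTo hy2⟩
  · filter_upwards [hV] with y hy1 hy2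
    rw [hφ.consistent₂.apply_eq_self ⟨hy1, hy2.2⟩, hφ.consistent₁.apply_eq_self ⟨hy1, hy2.1⟩]

end StepEstimates

/-- Uniform version of `IsStrictlyFlatAt.infDist_add_le_of_mem_tangentVectors` on a compact
set. -/
lemma IsCompact.exists_infDist_add_le_of_mem_tangentVectors {M K : Set E} (hK : IsCompact K)
    (hKM : K ⊆ M) (hflat : ∀ x ∈ K, ∃ T : Submodule ℝ E, IsStrictlyFlatAt M x T) {ε : ℝ}
    (hε : 0 < ε) :
    ∃ r > 0, ∀ x ∈ K, ∀ v ∈ tangentVectors M x, ‖v‖ ≤ r → infDist (x + v) M ≤ ε * ‖v‖ := by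
  refine hK.induction_on (p := fun s => ∃ r > 0, ∀ x ∈ s, ∀ v ∈ tangentVectors M x, ‖v‖ ≤ r →
    infDist (x + v) M ≤ ε * ‖v‖) ⟨1, one_pos, by simp⟩ ?_ ?_ ?_
  · rintro s t hst ⟨r, hr, h⟩
    exact ⟨r, hr, fun x hx => h x (hst hx)⟩
  · rintro s t ⟨r, hr, h⟩ ⟨r', hr', h'⟩
    refine ⟨min r r', lt_min hr hr', fun x hx v hv hvr => ?_⟩
    rcases hx with hx | hx
    · exact h x hx v hv (hvr.trans (min_le_left _ _))
    · exact h' x hx v hv (hvr.trans (min_le_right _ _))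
  · intro x hx
    obtain ⟨T, hT⟩ := hflat x hx
    obtain ⟨r, hr, h⟩ := hT.infDist_add_le_of_mem_tangentVectors hε
    exact ⟨ball x r ∩ K, inter_mem (mem_nhdsWithin_of_mem_nhds (ball_mem_nhds x hr))
      self_mem_nhdsWithin, r, hr,
      fun z hz => h z ⟨hKM hz.2, hz.1⟩⟩

end FiniteDimensional

/-! ### Convergence of the iteration and comparison of its limit with the projection -/

theorem mainTheorem5
    {E : Type*} [NormedAddCommGroup E] [InnerProductSpace ℝ E] [FiniteDimensional ℝ E]
    (p : ℕ) (hp : 2 ≤ p) (M₁ M₂ : Set E)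
    (hM₁ : IsEmbeddedSubmanifold p M₁) (hM₂ : IsEmbeddedSubmanifold p M₂)
    -- the base point, its relatively open neighbourhood in `M₁ ∩ M₂`, and the relative closure
    (xbar : E) (Ω K : Set E) (hxΩ : xbar ∈ Ω)
    (hΩ : ∃ O : Set E, IsOpen O ∧ Ω = M₁ ∩ M₂ ∩ O)
    (hKΩ : K = closure Ω ∩ (M₁ ∩ M₂)) (hK : IsCompact K)
    -- clean intersection at every point of `K`
    (hclean : ∀ x ∈ K, IntersectCleanlyAt p M₁ M₂ x)
    -- the maps are given on `U`, and the framework holds near every point of `K`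
    (U : Set E) (φ₁ φ₂ : E → E)
    (hφ : ∀ x ∈ K, ∃ V ⊆ U, x ∈ V ∧ FirstOrderFramework p M₁ M₂ φ₁ φ₂ V) :
    ∃ δ > 0, ∃ ρ > 0, ∃ τ ∈ Ioo (0 : ℝ) 1, ∃ C > 0, ∃ ψ : E → E → E,
      -- `τ` is a contraction factor of the distance to `M₂` on `M₁` near `K`
      Metric.thickening δ K ⊆ U ∧
      (∀ y ∈ M₁ ∩ Metric.thickening δ K, φ₂ y ∈ U ∧
        Metric.infDist (φ₁ (φ₂ y)) M₂ ≤ τ * Metric.infDist y M₂) ∧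
      (∀ x ∈ K, ∀ η ∈ tangentVectors (M₁ ∩ M₂) x, ‖η‖ ≤ ρ →
        -- all iterates are well defined
        (∀ k : ℕ, (φ₁ ∘ φ₂)^[k] (x + η) ∈ U ∧ φ₂ ((φ₁ ∘ φ₂)^[k] (x + η)) ∈ U) ∧
        -- they converge, with the unique limit `ψ x η`
        ψ x η ∈ (M₁ ∩ M₂) ∩ Metric.thickening δ K ∧
        (∀ y : E, Tendsto (fun k : ℕ => (φ₁ ∘ φ₂)^[k] (x + η)) atTop (𝓝 y) ↔ y = ψ x η) ∧
        -- the projection of the initial point is single-valued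
        (∃ z : E, metricProj (M₁ ∩ M₂) (x + η) = {z}) ∧
        -- `R`-linear rate
        (∀ k : ℕ, ‖(φ₁ ∘ φ₂)^[k] (x + η) - ψ x η‖ ≤ C * τ ^ k * ‖η‖)) ∧
      -- first-order agreement with the projection, uniformly on `K`
      (∀ ε > 0, ∃ r > 0, ∀ x ∈ K, ∀ η ∈ tangentVectors (M₁ ∩ M₂) x, ‖η‖ ≤ ρ → ‖η‖ ≤ r →
        ∀ z ∈ metricProj (M₁ ∩ M₂) (x + η), ‖ψ x η - z‖ ≤ ε * ‖η‖) := by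
  have hKM : K ⊆ M₁ ∩ M₂ := hKΩ ▸ inter_subset_right
  have hloc : ∀ x ∈ K, (∃ T : Submodule ℝ E, IsStrictlyFlatAt (M₁ ∩ M₂) x T) ∧
      ∃ δ > 0, ∃ τ ∈ Ioo (0 : ℝ) 1, ∃ C > 0, StepEstimates M₁ M₂ U φ₁ φ₂ {x} δ τ C := by
    intro x hx
    obtain ⟨V, hVU, hxV, hV⟩ := hφ x hx
    exact StepEstimates.exists_of_framework hp hM₁ hM₂ (hclean x hx) hVU hxV hV
  obtain ⟨δ, hδ, τ, hτ, C, hC, hest⟩ :=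
    StepEstimates.exists_of_isCompact hK fun x hx => (hloc x hx).2
  have hτ1 : 0 < 1 - τ := sub_pos.2 hτ.2
  have hτ0 : 0 < τ := hτ.1
  set D := C / (1 - τ) with hD
  have hD0 : 0 < D := div_pos hC hτ1
  -- the iterates stay within `C * (1 + D) * ‖η‖` of `x`, nearest points within `2 * ‖η‖`
  set B := 2 + C * (1 + D) with hB
  have hB0 : 0 < B := by positivity
  set ρ := δ / (2 * B) with hρ
  have hρ0 : 0 < ρ := by positivity
  have hBρ : B * ρ < δ := by
    have : B * ρ = δ / 2 := by rw [hρ]; field_simp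
    linarith
  -- one step from the start: the iterates and their limit, compared with any nearby `z ∈ M`
  have key : ∀ x ∈ K, ∀ η : E, ‖η‖ ≤ ρ →
      x + η ∈ ball x δ ∧ (∀ k : ℕ, (φ₁ ∘ φ₂)^[k] (x + η) ∈ ball x δ) ∧
      ∃ l ∈ M₁ ∩ M₂ ∩ ball x δ,
        Tendsto (fun k : ℕ => (φ₁ ∘ φ₂)^[k] (x + η)) atTop (𝓝 l) ∧
        ∀ z ∈ M₁ ∩ M₂ ∩ ball x δ, ‖φ₁ (φ₂ (x + η)) - z‖ ≤ C * ‖x + η - z‖ ∧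
          ∀ k : ℕ, ‖(φ₁ ∘ φ₂)^[k + 1] (x + η) - l‖ ≤ D * C * τ ^ k * ‖x + η - z‖ := by
    intro x hx η hη
    have hBη : B * ‖η‖ < δ := lt_of_le_of_lt (by gcongr) hBρ
    have hCη : 0 ≤ C * (1 + D) * ‖η‖ := by positivity
    have hx0 : x + η ∈ ball x δ := by
      rw [mem_ball, dist_eq_norm, add_sub_cancel_left]
      nlinarith [norm_nonneg η]
    set y := φ₁ (φ₂ (x + η)) with hy
    have hyM : y ∈ M₁ := (hest.mem x hx _ hx0).2.2
    have hz1 : ∀ z ∈ M₁ ∩ M₂ ∩ ball x δ, ‖y - z‖ ≤ C * ‖x + η - z‖ := fun z hz =>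
      hest.norm_sub_le x hx _ hx0 z hz
    have hz2 : ∀ z ∈ M₁ ∩ M₂ ∩ ball x δ, infDist y M₂ ≤ C * ‖x + η - z‖ := fun z hz =>
      (infDist_le_dist_of_mem hz.1.2).trans (by rw [dist_eq_norm]; exact hz1 z hz)
    have hxx : x ∈ M₁ ∩ M₂ ∩ ball x δ := ⟨hKM hx, mem_ball_self hδ⟩
    have hyδ : dist y x + C / (1 - τ) * infDist y M₂ < δ := by
      have h1 := hz1 x hxx
      have h2 : D * infDist y M₂ ≤ D * (C * ‖x + η - x‖) := by gcongr; exact hz2 x hxx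
      rw [add_sub_cancel_left] at h1 h2
      rw [dist_eq_norm, ← hD]
      nlinarith [norm_nonneg η]
    obtain ⟨hball, l, hl, hlim, hrate⟩ := hest.exists_tendsto hτ hC hx hyM hyδ
    have hsucc : ∀ k : ℕ, (φ₁ ∘ φ₂)^[k + 1] (x + η) = (φ₁ ∘ φ₂)^[k] y := fun k =>
      Function.iterate_succ_apply _ _ _
    refine ⟨hx0, fun k => ?_, l, hl, ?_, fun z hz => ⟨hz1 z hz, fun k => ?_⟩⟩
    · cases k with
      | zero => exact hx0
      | succ k => rw [hsucc]; exact hball k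
    · rw [← tendsto_add_atTop_iff_nat 1]
      simpa only [hsucc] using hlim
    · rw [hsucc]
      refine (hrate k).trans ?_
      calc D * τ ^ k * infDist y M₂ ≤ D * τ ^ k * (C * ‖x + η - z‖) := by
            gcongr; exact hz2 z hz
        _ = D * C * τ ^ k * ‖x + η - z‖ := by ring
  have hψ : ∀ x η : E, ∃ l : E, x ∈ K → ‖η‖ ≤ ρ → l ∈ M₁ ∩ M₂ ∩ ball x δ ∧
      Tendsto (fun k : ℕ => (φ₁ ∘ φ₂)^[k] (x + η)) atTop (𝓝 l) ∧
      ∀ z ∈ M₁ ∩ M₂ ∩ ball x δ, ‖φ₁ (φ₂ (x + η)) - z‖ ≤ C * ‖x + η - z‖ ∧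
        ∀ k : ℕ, ‖(φ₁ ∘ φ₂)^[k + 1] (x + η) - l‖ ≤ D * C * τ ^ k * ‖x + η - z‖ := by
    intro x η
    by_cases hx : x ∈ K ∧ ‖η‖ ≤ ρ
    · obtain ⟨-, -, l, h1, h2, h3⟩ := key x hx.1 η hx.2
      exact ⟨l, fun _ _ => ⟨h1, h2, h3⟩⟩
    · exact ⟨0, fun h1 h2 => absurd ⟨h1, h2⟩ hx⟩
  choose ψ hψ using hψ
  refine ⟨δ, hδ, ρ, hρ0, τ, hτ, 1 + C + D * C + D * C / τ, by positivity, ψ, ?_, ?_, ?_, ?_⟩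
  · intro y hy
    obtain ⟨x, hx, hyx⟩ := mem_thickening_iff.1 hy
    exact (hest.mem x hx y hyx).1
  · rintro y ⟨hyM, hy⟩
    obtain ⟨x, hx, hyx⟩ := mem_thickening_iff.1 hy
    exact ⟨(hest.mem x hx y hyx).2.1, hest.contracts x hx y ⟨hyM, hyx⟩⟩
  · intro x hx η _ hηρ
    obtain ⟨hx0, hball, -⟩ := key x hx η hηρ
    obtain ⟨hl, hlim, hrate⟩ := hψ x η hx hηρ
    refine ⟨fun k => ?_, ⟨hl.1, mem_thickening_iff.2 ⟨x, hx, hl.2⟩⟩, fun y => ?_,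
      hest.single_valued x hx _ hx0, fun k => ?_⟩
    · have h1 := hest.mem x hx _ (hball k)
      exact ⟨h1.1, h1.2.1⟩
    · exact ⟨fun hy => tendsto_nhds_unique hy hlim, fun hy => hy ▸ hlim⟩
    · obtain ⟨h1, h2⟩ := hrate x ⟨hKM hx, mem_ball_self hδ⟩
      rw [add_sub_cancel_left] at h1 h2
      have hη0 := norm_nonneg η
      cases k with
      | zero =>
        have h3 := h2 0
        rw [zero_add, Function.iterate_one, pow_zero, mul_one, Function.comp_apply] at h3
        have h4 : ‖x + η - ψ x η‖ ≤ ‖η‖ + ‖φ₁ (φ₂ (x + η)) - x‖ +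
            ‖φ₁ (φ₂ (x + η)) - ψ x η‖ := by
          have e : x + η - ψ x η = η - (φ₁ (φ₂ (x + η)) - x) +
              (φ₁ (φ₂ (x + η)) - ψ x η) := by abel
          rw [e]
          exact (norm_add_le _ _).trans (by gcongr; exact norm_sub_le _ _)
        have h5 : 0 ≤ D * C / τ * ‖η‖ := by positivity
        rw [Function.iterate_zero_apply, pow_zero, mul_one]
        linarith
      | succ k =>
        refine (h2 k).trans ?_
        have h3 : D * C * τ ^ k = D * C / τ * τ ^ (k + 1) := by
          rw [pow_succ]; field_simp
        rw [h3]
        gcongr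
        have : 0 ≤ 1 + C + D * C := by positivity
        linarith
  · intro ε hε
    have hA : 0 < D * C + C := by positivity
    obtain ⟨r, hr, h⟩ := hK.exists_infDist_add_le_of_mem_tangentVectors hKM
      (fun x hx => (hloc x hx).1) (div_pos hε hA)
    refine ⟨r, hr, fun x hx η hη hηρ hηr z hz => ?_⟩
    have hzδ : z ∈ ball x δ := by
      have h1 : x + η ∈ ball x (δ / 2) := by
        rw [mem_ball, dist_eq_norm, add_sub_cancel_left]
        have h2 : 2 * ρ ≤ B * ρ := by
          gcongr
          have : 0 ≤ C * (1 + D) := by positivity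
          linarith
        linarith
      exact mem_ball_of_mem_metricProj (hKM hx) h1 hz
    obtain ⟨h1, h2⟩ := (hψ x η hx hηρ).2.2 z ⟨hz.1, hzδ⟩
    have h3 := h2 0
    rw [zero_add, Function.iterate_one, pow_zero, mul_one, Function.comp_apply] at h3
    have h4 := norm_sub_le_norm_sub_add_norm_sub (ψ x η) (φ₁ (φ₂ (x + η))) z
    rw [norm_sub_rev (ψ x η) (φ₁ (φ₂ (x + η)))] at h4
    have h5 := h x hx η hη hηr
    rw [infDist_eq_of_mem_metricProj hz, norm_sub_rev] at h5
    calc ‖ψ x η - z‖ ≤ (D * C + C) * ‖x + η - z‖ := by linarith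
      _ ≤ (D * C + C) * (ε / (D * C + C) * ‖η‖) := by gcongr
      _ = ε * ‖η‖ := by field_simp
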